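/- Let $H^2(\mathbb{D})$ be the Hardy space of functions $f(z)=\sum_{n\ge 0}a_nz^n$ on the open unit disc $\mathbb{D}$ with $\|f\|^2=\sum_{n\ge 0}|a_n|^2<\infty$. For a bounded analytic function $\varphi$ on $\mathbb{D}$ let $M_\varphi f=\varphi f$ be the corresponding multiplication operator on $H^2(\mathbb{D})$ and $M_\varphi^*$ its Hilbert space adjoint. For bounded operators $R,T$ on $H^2(\mathbb{D})$ put $C_{R,T}(S)=RST$. Write $\mathcal{L}(H^2(\mathbb{D}))$ for the space of bounded operators, $\mathcal{K}(H^2(\mathbb{D}))$ for the space of compact operators, and, for $1\le p<\infty$, $S_p(H^2(\mathbb{D}))$ for the Schatten class of all bounded operators $T$ with $\|T\|_p=\big(\sum_{n\ge 1}a_n(T)^p\big)^{1/p}<\infty$, where $a_n(T)=\inf\{\|T-F\|:\operatorname{rank}F<n\}$. Let COT denote the topology of uniform convergence on compact sets. A continuous linear operator $T$ on a topological vector space $X$ is frequently hypercyclic if there is $x\in X$ such that for every non-empty open $U\subset X$ one has $\liminf_{N\to\infty}\frac1N\operatorname{card}\{1\le n\le N: T^nx\in U\}>0$. Let $\varphi$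 and $\psi$ be bounded analytic functions on $\mathbb{D}$, neither of them identically zero and at least one of them non-constant. (1) If $|\varphi(z)\psi(w)|=1$ for some $z,w\in\mathbb{D}$, then $C_{M_\varphi^*,M_\psi}$ is frequently hypercyclic on $(S_p(H^2(\mathbb{D})),\|\cdot\|_p)$ for every $1\le p<\infty$, on $\mathcal{K}(H^2(\mathbb{D}))$ with the operator norm, and on $(\mathcal{L}(H^2(\mathbb{D})),\mathrm{COT})$. (2) Conversely, if $C_{M_\varphi^*,M_\psi}$ is frequently hypercyclic on $\mathcal{K}(H^2(\mathbb{D}))$ with the operator norm, or on $(S_p(H^2(\mathbb{D})),\|\cdot\|_p)$ for some $1\le p<\infty$, then $|\varphi(z)\psi(w)|=1$ for some $z,w\in\mathbb{D}$. -/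

import Mathlib

open scoped InnerProductSpace CompactConvergenceCLM Complex.UnitDisc

noncomputable section

/-! ### Frequent hypercyclicity -/

/-- The lower density `liminf_{N → ∞} card {n ∈ A : 1 ≤ n ≤ N} / N` of a set of natural numbers. -/
def lowerDensity (A : Set ℕ) : ℝ :=
  Filter.liminf (fun N : ℕ => ((A ∩ Set.Icc 1 N).ncard : ℝ) / N) Filter.atTop

/-- A continuous operator `T` is frequently hypercyclic if some orbit visits every non-empty open
set along a set of times of positive lower density. -/
def FrequentlyHypercyclic {X : Type*} [AddCommGroup X] [Module ℂ X] [TopologicalSpace X]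
    (T : X →L[ℂ] X) : Prop :=
  ∃ x : X, ∀ U : Set X, IsOpen U → U.Nonempty → 0 < lowerDensity {n : ℕ | (⇑T)^[n] x ∈ U}

/-! ### Approximation numbers and the Schatten classes -/

section Schatten

variable {H : Type*} [NormedAddCommGroup H] [InnerProductSpace ℂ H]

/-- The `n`-th approximation number `inf {‖T - F‖ : rank F < n}` (used for `n ≥ 1`). -/
def approxNumber (T : H →L[ℂ] H) (n : ℕ) : ℝ :=
  sInf {r : ℝ | ∃ F : H →L[ℂ] H, (F : H →ₗ[ℂ] H).rank < (n : Cardinal) ∧ r = ‖T - F‖}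

theorem approxNumber_nonneg (T : H →L[ℂ] H) (n : ℕ) : 0 ≤ approxNumber T n := by
  apply Real.sInf_nonneg
  rintro r ⟨F, -, rfl⟩
  exact norm_nonneg _

theorem approxNumber_le {T F : H →L[ℂ] H} {n : ℕ}
    (hF : (F : H →ₗ[ℂ] H).rank < (n : Cardinal)) : approxNumber T n ≤ ‖T - F‖ := by
  apply csInf_le
  · refine ⟨0, ?_⟩
    rintro r ⟨F, -, rfl⟩
    exact norm_nonneg _
  · exact ⟨F, hF, rfl⟩

theorem exists_approx (T : H →L[ℂ] H) (n : ℕ) {ε : ℝ} (hε : 0 < ε) :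
    ∃ F : H →L[ℂ] H, (F : H →ₗ[ℂ] H).rank < ((n + 1 : ℕ) : Cardinal) ∧
      ‖T - F‖ < approxNumber T (n + 1) + ε := by
  have hne : {r : ℝ | ∃ F : H →L[ℂ] H,
      (F : H →ₗ[ℂ] H).rank < ((n + 1 : ℕ) : Cardinal) ∧ r = ‖T - F‖}.Nonempty := by
    refine ⟨_, 0, ?_, rfl⟩
    have : ((0 : H →L[ℂ] H) : H →ₗ[ℂ] H) = 0 := rfl
    rw [this, LinearMap.rank_zero]
    exact_mod_cast Nat.succ_pos n
  obtain ⟨r, ⟨F, hF, rfl⟩, hr⟩ := exists_lt_of_csInf_lt hne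
    (lt_add_of_pos_right (approxNumber T (n + 1)) hε)
  exact ⟨F, hF, hr⟩

theorem approxNumber_zero (n : ℕ) : approxNumber (0 : H →L[ℂ] H) (n + 1) = 0 := by
  refine le_antisymm ?_ (approxNumber_nonneg _ _)
  have h : ((0 : H →L[ℂ] H) : H →ₗ[ℂ] H).rank < ((n + 1 : ℕ) : Cardinal) := by
    have : ((0 : H →L[ℂ] H) : H →ₗ[ℂ] H) = 0 := rfl
    rw [this, LinearMap.rank_zero]
    exact_mod_cast Nat.succ_pos n
  simpa using approxNumber_le (T := 0) h

theorem approxNumber_succ_le (T : H →L[ℂ] H) (n : ℕ) :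
    approxNumber T (n + 2) ≤ approxNumber T (n + 1) := by
  refine le_of_forall_pos_le_add fun ε hε => ?_
  obtain ⟨F, hF, h⟩ := exists_approx T n hε
  refine (approxNumber_le (hF.trans ?_)).trans h.le
  exact_mod_cast Nat.lt_succ_self _

theorem approxNumber_add_le (S T : H →L[ℂ] H) (m n : ℕ) :
    approxNumber (S + T) (m + n + 1) ≤ approxNumber S (m + 1) + approxNumber T (n + 1) := by
  refine le_of_forall_pos_le_add fun ε hε => ?_
  obtain ⟨F, hF, h⟩ := exists_approx S m (half_pos hε)
  obtain ⟨G, hG, h'⟩ := exists_approx T n (half_pos hε)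
  have hr : ((F + G : H →L[ℂ] H) : H →ₗ[ℂ] H).rank < ((m + n + 1 : ℕ) : Cardinal) := by
    have e : ((F + G : H →L[ℂ] H) : H →ₗ[ℂ] H) = (F : H →ₗ[ℂ] H) + (G : H →ₗ[ℂ] H) := rfl
    have hF' : (F : H →ₗ[ℂ] H).rank ≤ (m : Cardinal) := by
      rw [Nat.cast_succ, ← Cardinal.succ_natCast] at hF
      exact Order.lt_succ_iff.1 hF
    have hG' : (G : H →ₗ[ℂ] H).rank ≤ (n : Cardinal) := by
      rw [Nat.cast_succ, ← Cardinal.succ_natCast] at hG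
      exact Order.lt_succ_iff.1 hG
    rw [e]
    refine (LinearMap.rank_add_le _ _).trans_lt ((add_le_add hF' hG').trans_lt ?_)
    exact_mod_cast Nat.lt_succ_self _
  refine (approxNumber_le hr).trans ?_
  have : S + T - (F + G) = (S - F) + (T - G) := by abel
  rw [this]
  linarith [norm_add_le (S - F) (T - G)]

theorem approxNumber_comp_le (R S T : H →L[ℂ] H) (n : ℕ) :
    approxNumber (R ∘L S ∘L T) (n + 1) ≤ ‖R‖ * ‖T‖ * approxNumber S (n + 1) := by
  have key : ∀ ε > 0, approxNumber (R ∘L S ∘L T) (n + 1) ≤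
      ‖R‖ * ‖T‖ * (approxNumber S (n + 1) + ε) := by
    intro ε hε
    obtain ⟨F, hF, h⟩ := exists_approx S n hε
    have hr : ((R ∘L F ∘L T : H →L[ℂ] H) : H →ₗ[ℂ] H).rank < ((n + 1 : ℕ) : Cardinal) := by
      have e : ((R ∘L F ∘L T : H →L[ℂ] H) : H →ₗ[ℂ] H) =
        (R : H →ₗ[ℂ] H) ∘ₗ ((F : H →ₗ[ℂ] H) ∘ₗ (T : H →ₗ[ℂ] H)) := rfl
      rw [e]
      exact ((LinearMap.rank_comp_le_right _ _).trans
        (LinearMap.rank_comp_le_left _ _)).trans_lt hF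
    refine (approxNumber_le hr).trans ?_
    have e : R ∘L S ∘L T - R ∘L F ∘L T = R ∘L (S - F) ∘L T := by
      ext x; simp
    rw [e]
    calc ‖R ∘L (S - F) ∘L T‖ ≤ ‖R‖ * (‖S - F‖ * ‖T‖) :=
          (R.opNorm_comp_le _).trans
            (mul_le_mul_of_nonneg_left ((S - F).opNorm_comp_le T) (norm_nonneg _))
      _ = ‖R‖ * ‖T‖ * ‖S - F‖ := by ring
      _ ≤ _ := by gcongr
  have hlim : Filter.Tendsto (fun ε : ℝ => ‖R‖ * ‖T‖ * (approxNumber S (n + 1) + ε))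
      (nhdsWithin 0 (Set.Ioi 0)) (nhds (‖R‖ * ‖T‖ * (approxNumber S (n + 1) + 0))) := by
    apply Filter.Tendsto.mono_left _ nhdsWithin_le_nhds
    exact (Continuous.tendsto (by fun_prop) 0)
  rw [add_zero] at hlim
  exact ge_of_tendsto hlim (Filter.eventually_of_mem self_mem_nhdsWithin fun ε hε => key ε hε)

theorem summable_approxNumber_comp {p : ℝ} (hp : 1 ≤ p) (R T : H →L[ℂ] H) {S : H →L[ℂ] H}
    (hS : Summable fun n : ℕ => approxNumber S (n + 1) ^ p) :
    Summable fun n : ℕ => approxNumber (R ∘L S ∘L T) (n + 1) ^ p := by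
  refine Summable.of_nonneg_of_le (fun n => Real.rpow_nonneg (approxNumber_nonneg _ _) _)
    (fun n => ?_) (hS.mul_left ((‖R‖ * ‖T‖) ^ p))
  rw [← Real.mul_rpow (by positivity) (approxNumber_nonneg _ _)]
  exact Real.rpow_le_rpow (approxNumber_nonneg _ _) (approxNumber_comp_le R S T n) (by linarith)

theorem summable_approxNumber_add {p : ℝ} (hp : 1 ≤ p) {S T : H →L[ℂ] H}
    (hS : Summable fun n : ℕ => approxNumber S (n + 1) ^ p)
    (hT : Summable fun n : ℕ => approxNumber T (n + 1) ^ p) :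
    Summable fun n : ℕ => approxNumber (S + T) (n + 1) ^ p := by
  have hp0 : 0 ≤ p := by linarith
  have heven : Summable fun n : ℕ => approxNumber (S + T) (2 * n + 1) ^ p := by
    refine Summable.of_nonneg_of_le (fun n => Real.rpow_nonneg (approxNumber_nonneg _ _) _)
      (fun n => ?_) ((hS.add hT).mul_left ((2 : ℝ) ^ (p - 1)))
    have h := approxNumber_add_le S T n n
    rw [← two_mul] at h
    have h' := NNReal.rpow_add_le_mul_rpow_add_rpow (approxNumber S (n + 1)).toNNReal
      (approxNumber T (n + 1)).toNNReal hp
    rw [← NNReal.coe_le_coe] at h'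
    simp only [NNReal.coe_mul, NNReal.coe_add, NNReal.coe_rpow, NNReal.coe_ofNat,
      Real.coe_toNNReal _ (approxNumber_nonneg S (n + 1)),
      Real.coe_toNNReal _ (approxNumber_nonneg T (n + 1))] at h'
    exact (Real.rpow_le_rpow (approxNumber_nonneg _ _) h hp0).trans h'
  have hodd : Summable fun n : ℕ => approxNumber (S + T) (2 * n + 1 + 1) ^ p :=
    Summable.of_nonneg_of_le (fun n => Real.rpow_nonneg (approxNumber_nonneg _ _) _)
      (fun n => Real.rpow_le_rpow (approxNumber_nonneg _ _) (approxNumber_succ_le _ _) hp0) heven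
  exact (heven.hasSum.even_add_odd (f := fun n : ℕ => approxNumber (S + T) (n + 1) ^ p)
    hodd.hasSum).summable

/-- The Schatten class of exponent `p ∈ [1, ∞)` as a linear subspace of the bounded operators. -/
def schattenSubmodule (H : Type*) [NormedAddCommGroup H] [InnerProductSpace ℂ H]
    (p : ℝ) (hp : 1 ≤ p) : Submodule ℂ (H →L[ℂ] H) where
  carrier := {T | Summable fun n : ℕ => approxNumber T (n + 1) ^ p}
  zero_mem' := by
    have : p ≠ 0 := by linarith
    simp [approxNumber_zero, Real.zero_rpow this, summable_zero]
  add_mem' := fun hS hT => summable_approxNumber_add hp hS hT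
  smul_mem' := fun c T hT => by
    have h := summable_approxNumber_comp hp (c • ContinuousLinearMap.id ℂ H)
      (ContinuousLinearMap.id ℂ H) hT
    have e : (c • ContinuousLinearMap.id ℂ H) ∘L T ∘L ContinuousLinearMap.id ℂ H = c • T := by
      ext x; simp
    rwa [e] at h

/-- The Schatten class `S_p(H)`. It is a separate type, so that it does not carry the operator
norm but the topology of the Schatten norm, defined below. -/
def SchattenClass (H : Type*) [NormedAddCommGroup H] [InnerProductSpace ℂ H]
    (p : ℝ) (hp : 1 ≤ p) : Type _ :=
  ↥(schattenSubmodule H p hp)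

namespace SchattenClass

variable {p : ℝ} {hp : 1 ≤ p}

instance : AddCommGroup (SchattenClass H p hp) :=
  inferInstanceAs (AddCommGroup ↥(schattenSubmodule H p hp))

instance : Module ℂ (SchattenClass H p hp) :=
  inferInstanceAs (Module ℂ ↥(schattenSubmodule H p hp))

/-- The bounded operator underlying an element of the Schatten class. -/
def toCLM : SchattenClass H p hp →ₗ[ℂ] (H →L[ℂ] H) := (schattenSubmodule H p hp).subtype

/-- The Schatten norm, the `ℓ^p`-norm of the sequence of approximation numbers. -/
def schattenNorm (T : SchattenClass H p hp) : ℝ :=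
  (∑' n : ℕ, approxNumber (toCLM T) (n + 1) ^ p) ^ (1 / p)

/-- The topology of the Schatten norm: a set is open if it contains, with each of its points, a
ball around that point. -/
instance : TopologicalSpace (SchattenClass H p hp) where
  IsOpen U := ∀ T ∈ U, ∃ ε > 0, ∀ S, schattenNorm (S - T) < ε → S ∈ U
  isOpen_univ := fun _ _ => ⟨1, one_pos, fun _ _ => trivial⟩
  isOpen_inter := by
    rintro U V hU hV T ⟨hTU, hTV⟩
    obtain ⟨ε, hε, h⟩ := hU T hTU
    obtain ⟨δ, hδ, h'⟩ := hV T hTV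
    exact ⟨min ε δ, lt_min hε hδ, fun S hS =>
      ⟨h S (hS.trans_le (min_le_left _ _)), h' S (hS.trans_le (min_le_right _ _))⟩⟩
  isOpen_sUnion := by
    rintro s hs T ⟨U, hU, hTU⟩
    obtain ⟨ε, hε, h⟩ := hs U hU T hTU
    exact ⟨ε, hε, fun S hS => ⟨U, hU, h S hS⟩⟩

end SchattenClass

/-! ### The maps `S ↦ R S T` -/

/-- The map `S ↦ R S T` on the bounded operators with the operator norm. -/
def conjBounded (R T : H →L[ℂ] H) : (H →L[ℂ] H) →L[ℂ] (H →L[ℂ] H) :=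
  (ContinuousLinearMap.compL ℂ H H H R) ∘L ((ContinuousLinearMap.compL ℂ H H H).flip T)

theorem conjBounded_apply (R T S : H →L[ℂ] H) : conjBounded R T S = R ∘L S ∘L T := rfl

/-- The map `S ↦ R S T` on the compact operators with the operator norm. -/
def conjCompact (R T : H →L[ℂ] H) :
    ↥(compactOperator (RingHom.id ℂ) H H) →L[ℂ] ↥(compactOperator (RingHom.id ℂ) H H) :=
  (conjBounded R T ∘L (compactOperator (RingHom.id ℂ) H H).subtypeL).codRestrict
    (compactOperator (RingHom.id ℂ) H H)
    (fun S => IsCompactOperator.clm_comp (IsCompactOperator.comp_clm S.2 T) R)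

theorem conjCompact_apply (R T : H →L[ℂ] H) (S : ↥(compactOperator (RingHom.id ℂ) H H)) :
    (conjCompact R T S : H →L[ℂ] H) = R ∘L (S : H →L[ℂ] H) ∘L T := rfl

/-- The map `S ↦ R S T` on the bounded operators with the topology of uniform convergence on
compact sets. -/
def conjCOT (R T : H →L[ℂ] H) : (H →L_c[ℂ] H) →L[ℂ] (H →L_c[ℂ] H) :=
  (R.postcompCompactConvergenceCLM H) ∘L (T.precompCompactConvergenceCLM H)

theorem conjCOT_apply (R T : H →L[ℂ] H) (S : H →L_c[ℂ] H) (x : H) :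
    conjCOT R T S x = R (S (T x)) := rfl

/-- The map `S ↦ R S T` on the Schatten class. -/
def conjSchatten (p : ℝ) (hp : 1 ≤ p) (R T : H →L[ℂ] H) :
    SchattenClass H p hp →L[ℂ] SchattenClass H p hp where
  toLinearMap := ((conjBounded R T).toLinearMap ∘ₗ SchattenClass.toCLM).codRestrict
    (schattenSubmodule H p hp) (fun S => summable_approxNumber_comp hp R T S.2)
  cont := by
    set L : SchattenClass H p hp →ₗ[ℂ] SchattenClass H p hp :=
      ((conjBounded R T).toLinearMap ∘ₗ SchattenClass.toCLM).codRestrict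
        (schattenSubmodule H p hp) (fun S => summable_approxNumber_comp hp R T S.2) with hL
    have hp0 : 0 < p := by linarith
    have hbound : ∀ S : SchattenClass H p hp, SchattenClass.schattenNorm (L S) ≤
        ‖R‖ * ‖T‖ * SchattenClass.schattenNorm S := by
      intro S
      have hS : Summable fun n : ℕ => approxNumber (SchattenClass.toCLM S) (n + 1) ^ p := S.2
      have h1 : ∑' n : ℕ, approxNumber (SchattenClass.toCLM (L S)) (n + 1) ^ p ≤
          (‖R‖ * ‖T‖) ^ p * ∑' n : ℕ, approxNumber (SchattenClass.toCLM S) (n + 1) ^ p := by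
        rw [← tsum_mul_left]
        refine Summable.tsum_le_tsum (fun n => ?_) (L S).2 (hS.mul_left _)
        rw [← Real.mul_rpow (by positivity) (approxNumber_nonneg _ _)]
        exact Real.rpow_le_rpow (approxNumber_nonneg _ _) (approxNumber_comp_le R _ T n) hp0.le
      have h0 : ∀ S : SchattenClass H p hp,
          0 ≤ ∑' n : ℕ, approxNumber (SchattenClass.toCLM S) (n + 1) ^ p :=
        fun S => tsum_nonneg fun n => Real.rpow_nonneg (approxNumber_nonneg _ _) _
      refine (Real.rpow_le_rpow (h0 _) h1 (by positivity)).trans ?_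
      rw [Real.mul_rpow (by positivity) (h0 _), ← Real.rpow_mul (by positivity),
        mul_one_div_cancel hp0.ne', Real.rpow_one]
      rfl
    refine continuous_def.2 fun U hU => ?_
    intro S hS
    obtain ⟨ε, hε, h⟩ := hU (L S) hS
    refine ⟨ε / (‖R‖ * ‖T‖ + 1), by positivity, fun S' hS' => h (L S') ?_⟩
    rw [← map_sub]
    have hn : 0 ≤ SchattenClass.schattenNorm (S' - S) :=
      Real.rpow_nonneg (tsum_nonneg fun n => Real.rpow_nonneg (approxNumber_nonneg _ _) _) _
    refine (hbound _).trans_lt ?_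
    rw [lt_div_iff₀ (by positivity)] at hS'
    nlinarith

theorem conjSchatten_apply (p : ℝ) (hp : 1 ≤ p) (R T : H →L[ℂ] H) (S : SchattenClass H p hp) :
    SchattenClass.toCLM (conjSchatten p hp R T S) = R ∘L SchattenClass.toCLM S ∘L T := rfl

end Schatten

/-! ### The Hardy space of the disc -/

theorem summable_hardy (a : lp (fun _ : ℕ => ℂ) 2) {z : ℂ} (hz : ‖z‖ < 1) :
    Summable fun n : ℕ => a n * z ^ n := by
  refine Summable.of_norm_bounded
    ((summable_geometric_of_lt_one (norm_nonneg z) hz).mul_left ‖a‖) fun n => ?_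
  rw [norm_mul, norm_pow]
  exact mul_le_mul_of_nonneg_right (lp.norm_apply_le_norm (by norm_num) a n) (by positivity)

/-- The linear map sending `a ∈ ℓ²` to the function `z ↦ ∑ aₙ zⁿ` on the disc. -/
def powerSeriesMap : lp (fun _ : ℕ => ℂ) 2 →ₗ[ℂ] (𝔻 → ℂ) where
  toFun a z := ∑' n : ℕ, a n * (z : ℂ) ^ n
  map_add' a b := by
    ext z
    simp only [lp.coeFn_add, Pi.add_apply, add_mul]
    exact (summable_hardy a z.norm_lt_one).tsum_add (summable_hardy b z.norm_lt_one)
  map_smul' c a := by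
    ext z
    simp only [lp.coeFn_smul, Pi.smul_apply, smul_eq_mul, mul_assoc, RingHom.id_apply]
    exact tsum_mul_left

theorem powerSeries_hasFPowerSeriesOnBall (a : lp (fun _ : ℕ => ℂ) 2) :
    HasFPowerSeriesOnBall (fun z : ℂ => ∑' n : ℕ, a n * z ^ n)
      (FormalMultilinearSeries.ofScalars ℂ (fun n => a n)) 0 1 := by
  refine ⟨?_, one_pos, ?_⟩
  · refine ENNReal.le_of_forall_nnreal_lt fun r hr => ?_
    have hr1 : (r : ℝ) < 1 := by exact_mod_cast hr
    refine FormalMultilinearSeries.le_radius_of_bound _ ‖a‖ fun n => ?_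
    have h1 : ‖FormalMultilinearSeries.ofScalars ℂ (fun n => a n) n‖ ≤ ‖a‖ := by
      rw [FormalMultilinearSeries.ofScalars_norm]
      exact lp.norm_apply_le_norm (by norm_num) a n
    have h2 : (r : ℝ) ^ n ≤ 1 := pow_le_one₀ r.2 hr1.le
    have h3 : (0 : ℝ) ≤ (r : ℝ) ^ n := pow_nonneg r.2 n
    nlinarith [norm_nonneg a]
  · intro z hz
    have hz' : ‖z‖ < 1 := by
      rw [← ENNReal.ofReal_one, Metric.eball_ofReal] at hz
      simpa using hz
    simpa [FormalMultilinearSeries.ofScalars_apply_eq, mul_comm] using (summable_hardy a hz').hasSum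

/-- Uniqueness of power series coefficients on the disc. -/
theorem powerSeriesMap_injective : Function.Injective powerSeriesMap := by
  rw [← LinearMap.ker_eq_bot, LinearMap.ker_eq_bot']
  intro a ha
  have h1 : (fun z : ℂ => ∑' n : ℕ, a n * z ^ n) =ᶠ[nhds 0] fun _ => 0 := by
    filter_upwards [Metric.ball_mem_nhds (0 : ℂ) one_pos] with z hz
    exact congrFun ha (Complex.UnitDisc.mk z (by simpa using hz))
  have h2 := ((powerSeries_hasFPowerSeriesOnBall a).hasFPowerSeriesAt.congr h1).eq_zero
  ext n
  have h3 : (FormalMultilinearSeries.ofScalars ℂ (fun n => a n)).coeff n = 0 := by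
    rw [h2]; rfl
  simpa [FormalMultilinearSeries.coeff_ofScalars] using h3

/-- The Hardy space `H²(𝔻)`: the functions `f(z) = ∑ aₙ zⁿ` on the disc with `∑ |aₙ|² < ∞`, with
`‖f‖² = ∑ |aₙ|²`. -/
def HardySpace : Type := ↥(LinearMap.range powerSeriesMap)

namespace HardySpace

instance : AddCommGroup HardySpace :=
  inferInstanceAs (AddCommGroup ↥(LinearMap.range powerSeriesMap))

instance : Module ℂ HardySpace :=
  inferInstanceAs (Module ℂ ↥(LinearMap.range powerSeriesMap))

instance : CoeFun HardySpace (fun _ => 𝔻 → ℂ) := ⟨Subtype.val⟩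

/-- The Taylor coefficients. -/
def coeffEquiv : HardySpace ≃ₗ[ℂ] lp (fun _ : ℕ => ℂ) 2 :=
  (LinearEquiv.ofInjective powerSeriesMap powerSeriesMap_injective).symm

theorem powerSeriesMap_coeffEquiv (f : HardySpace) : powerSeriesMap (coeffEquiv f) = f :=
  congrArg Subtype.val
    ((LinearEquiv.ofInjective powerSeriesMap powerSeriesMap_injective).apply_symm_apply f)

instance : NormedAddCommGroup HardySpace :=
  NormedAddCommGroup.induced HardySpace (lp (fun _ : ℕ => ℂ) 2) coeffEquiv coeffEquiv.injective

instance : InnerProductSpace ℂ HardySpace where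
  norm_smul_le c f := by
    change ‖coeffEquiv (c • f)‖ ≤ ‖c‖ * ‖coeffEquiv f‖
    rw [map_smul]
    exact norm_smul_le _ _
  inner f g := ⟪coeffEquiv f, coeffEquiv g⟫_ℂ
  norm_sq_eq_re_inner f := norm_sq_eq_re_inner (𝕜 := ℂ) (coeffEquiv f)
  conj_inner_symm f g := inner_conj_symm (𝕜 := ℂ) (coeffEquiv f) (coeffEquiv g)
  add_left f g h := by
    change ⟪coeffEquiv (f + g), coeffEquiv h⟫_ℂ = _
    rw [map_add]
    exact inner_add_left _ _ _
  smul_left f g c := by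
    change ⟪coeffEquiv (c • f), coeffEquiv g⟫_ℂ = _
    rw [map_smul]
    exact inner_smul_left _ _ _

theorem norm_def (f : HardySpace) : ‖f‖ = ‖coeffEquiv f‖ := rfl

/-- The Taylor coefficients identify `H²(𝔻)` isometrically with `ℓ²`. -/
def coeffIsometry : HardySpace ≃ₗᵢ[ℂ] lp (fun _ : ℕ => ℂ) 2 := ⟨coeffEquiv, fun _ => rfl⟩

instance : CompleteSpace HardySpace := coeffIsometry.toIsometryEquiv.completeSpace

end HardySpace

/-! ### Multiplication operators on the Hardy space -/

/-- `φ` is a bounded analytic function on the open unit disc. -/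
structure IsBoundedAnalytic (φ : ℂ → ℂ) : Prop where
  analytic : AnalyticOnNhd ℂ φ (Metric.ball 0 1)
  bounded : ∃ C : ℝ, ∀ z : 𝔻, ‖φ z‖ ≤ C

/-- Parseval's identity on the circle for an absolutely convergent series. -/
theorem parseval_circle {c : ℕ → ℂ} (hc : Summable fun n => ‖c n‖) :
    HasSum (fun n => ‖c n‖ ^ 2)
      (‖ContinuousMap.toLp 2 AddCircle.haarAddCircle ℂ
        (∑' n : ℕ, c n • (fourier (n : ℤ) : C(UnitAddCircle, ℂ)))‖ ^ 2) := by
  set v : ℕ → MeasureTheory.Lp ℂ 2 (AddCircle.haarAddCircle (T := (1 : ℝ))) :=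
    fun n => fourierLp 2 (n : ℤ) with hv
  have hvo : Orthonormal ℂ v :=
    (orthonormal_fourier (T := (1 : ℝ))).comp (fun n : ℕ => (n : ℤ)) Nat.cast_injective
  have hs : Summable fun n : ℕ => c n • (fourier (n : ℤ) : C(UnitAddCircle, ℂ)) := by
    refine Summable.of_norm ?_
    simpa [norm_smul, fourier_norm] using hc
  set F := ContinuousMap.toLp 2 AddCircle.haarAddCircle ℂ
        (∑' n : ℕ, c n • (fourier (n : ℤ) : C(UnitAddCircle, ℂ))) with hF
  have hFs : HasSum (fun n => c n • v n) F := by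
    have := (ContinuousMap.toLp 2 (AddCircle.haarAddCircle (T := (1 : ℝ))) ℂ).hasSum hs.hasSum
    simpa [hF, hv, fourierLp] using this
  have hin : ∀ n, ⟪v n, F⟫_ℂ = c n := by
    intro n
    have h1 := (innerSL ℂ (v n)).hasSum hFs
    have h2 : HasSum (fun m => (innerSL ℂ (v n)) (c m • v m)) (c n) := by
      have : (fun m => (innerSL ℂ (v n)) (c m • v m)) = fun m => if m = n then c n else 0 := by
        ext m
        rw [innerSL_apply_apply, inner_smul_right, orthonormal_iff_ite.1 hvo]
        by_cases h : n = m
        · simp [h]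
        · simp [h, Ne.symm h]
      rw [this]
      exact hasSum_ite_eq n (c n)
    exact h1.unique h2
  have h3 := (innerSL ℂ F).hasSum hFs
  have h4 := Complex.reCLM.hasSum h3
  have h5 : Complex.reCLM ((innerSL ℂ F) F) = ‖F‖ ^ 2 := by
    rw [innerSL_apply_apply, norm_sq_eq_re_inner (𝕜 := ℂ) F]
    rfl
  rw [h5] at h4
  refine h4.congr_fun ?_
  intro n
  rw [innerSL_apply_apply, inner_smul_right, ← inner_conj_symm, hin, Complex.mul_conj,
    Complex.reCLM_apply, Complex.ofReal_re, Complex.normSq_eq_norm_sq]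

theorem circle_series_apply {c : ℕ → ℂ} {r : ℝ} (hc : Summable fun n => ‖c n * (r : ℂ) ^ n‖)
    (x : UnitAddCircle) :
    (∑' n : ℕ, (c n * (r : ℂ) ^ n) • (fourier (n : ℤ) : C(UnitAddCircle, ℂ))) x =
      ∑' n : ℕ, c n * ((r : ℂ) * fourier 1 x) ^ n := by
  have hs : Summable fun n : ℕ =>
      (c n * (r : ℂ) ^ n) • (fourier (n : ℤ) : C(UnitAddCircle, ℂ)) := by
    refine Summable.of_norm ?_
    simpa only [norm_smul, fourier_norm, mul_one] using hc
  have h := (ContinuousMap.evalCLM ℂ x).map_tsum hs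
  refine h.trans (tsum_congr fun n => ?_)
  have : fourier (n : ℤ) x = (fourier 1 x : ℂ) ^ n := by
    rw [fourier_apply, fourier_apply, AddCircle.toCircle_zsmul, one_zsmul, zpow_natCast,
      Circle.coe_pow]
  change (c n * (r : ℂ) ^ n) * fourier (n : ℤ) x = _
  rw [this, mul_pow, mul_assoc]

/-- A bounded analytic multiplier maps `H²(𝔻)` into itself, with norm at most its supremum. -/
theorem exists_mul_coeff {φ : ℂ → ℂ} (hφ : AnalyticOnNhd ℂ φ (Metric.ball 0 1)) {C : ℝ}
    (hC : ∀ z : 𝔻, ‖φ z‖ ≤ C) (a : lp (fun _ : ℕ => ℂ) 2) :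
    ∃ b : lp (fun _ : ℕ => ℂ) 2,
      (powerSeriesMap b = fun z : 𝔻 => φ z * powerSeriesMap a z) ∧ ‖b‖ ≤ C * ‖a‖ := by
  have hC0 : 0 ≤ C := (norm_nonneg _).trans (hC 0)
  set f : ℂ → ℂ := fun z => ∑' n : ℕ, a n * z ^ n with hf
  have hfd : DifferentiableOn ℂ f (Metric.ball 0 1) := by
    have := (powerSeries_hasFPowerSeriesOnBall a).differentiableOn
    rwa [← ENNReal.ofReal_one, Metric.eball_ofReal] at this
  have hgd : DifferentiableOn ℂ (fun z => φ z * f z) (Metric.ball 0 1) :=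
    hφ.differentiableOn.mul hfd
  set b : ℕ → ℂ := fun n => (n.factorial : ℂ)⁻¹ * iteratedDeriv n (fun z => φ z * f z) 0 with hb
  have hbs : ∀ z : ℂ, ‖z‖ < 1 → HasSum (fun n => b n * z ^ n) (φ z * f z) := by
    intro z hz
    have := Complex.hasSum_taylorSeries_on_ball (c := 0) (r := 1) (z := z) hgd (by simpa using hz)
    refine this.congr_fun fun n => ?_
    simp only [hb, sub_zero, smul_eq_mul]
    ring
  have hasq : HasSum (fun n => ‖a n‖ ^ 2) (‖a‖ ^ 2) := by
    have := lp.hasSum_norm (p := 2) (by norm_num) a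
    simpa using this
  have key : ∀ r : ℝ, 0 ≤ r → r < 1 → ∀ N : ℕ,
      ∑ n ∈ Finset.range N, ‖b n‖ ^ 2 * (r ^ n) ^ 2 ≤ (C * ‖a‖) ^ 2 := by
    intro r hr0 hr1 N
    have hrn : ‖(r : ℂ)‖ < 1 := by rwa [Complex.norm_real, Real.norm_of_nonneg hr0]
    have hsb : Summable fun n => ‖b n * (r : ℂ) ^ n‖ := (hbs r hrn).summable.norm
    have hsa : Summable fun n => ‖a n * (r : ℂ) ^ n‖ := (summable_hardy a hrn).norm
    have hpb := parseval_circle hsb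
    have hpa := parseval_circle hsa
    have hle := MeasureTheory.Lp.norm_le_mul_norm_of_ae_le_mul (c := C)
      (f := ContinuousMap.toLp 2 AddCircle.haarAddCircle ℂ
        (∑' n : ℕ, (b n * (r : ℂ) ^ n) • (fourier (n : ℤ) : C(UnitAddCircle, ℂ))))
      (g := ContinuousMap.toLp 2 AddCircle.haarAddCircle ℂ
        (∑' n : ℕ, (a n * (r : ℂ) ^ n) • (fourier (n : ℤ) : C(UnitAddCircle, ℂ)))) (by
        filter_upwards [ContinuousMap.coeFn_toLp (p := 2) (𝕜 := ℂ) AddCircle.haarAddCircle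
          (∑' n : ℕ, (b n * (r : ℂ) ^ n) • (fourier (n : ℤ) : C(UnitAddCircle, ℂ))),
          ContinuousMap.coeFn_toLp (p := 2) (𝕜 := ℂ) AddCircle.haarAddCircle
          (∑' n : ℕ, (a n * (r : ℂ) ^ n) • (fourier (n : ℤ) : C(UnitAddCircle, ℂ)))] with x h1 h2
        rw [h1, h2, circle_series_apply hsb, circle_series_apply hsa]
        have hx : ‖(r : ℂ) * fourier 1 x‖ < 1 := by
          rw [norm_mul, fourier_apply, Circle.norm_coe, mul_one]
          exact hrn
        rw [(hbs _ hx).tsum_eq, norm_mul]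
        exact mul_le_mul_of_nonneg_right (hC (Complex.UnitDisc.mk _ hx)) (norm_nonneg _))
    have h1 : ∑ n ∈ Finset.range N, ‖b n‖ ^ 2 * (r ^ n) ^ 2 ≤ ‖ContinuousMap.toLp 2
        AddCircle.haarAddCircle ℂ
        (∑' n : ℕ, (b n * (r : ℂ) ^ n) • (fourier (n : ℤ) : C(UnitAddCircle, ℂ)))‖ ^ 2 := by
      refine le_trans (le_of_eq ?_) (sum_le_hasSum (Finset.range N) (fun n _ => sq_nonneg _) hpb)
      refine Finset.sum_congr rfl fun n _ => ?_
      rw [norm_mul (b n), norm_pow, Complex.norm_real, Real.norm_of_nonneg hr0, mul_pow]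
    have h2 : ‖ContinuousMap.toLp 2 AddCircle.haarAddCircle ℂ
        (∑' n : ℕ, (a n * (r : ℂ) ^ n) • (fourier (n : ℤ) : C(UnitAddCircle, ℂ)))‖ ^ 2 ≤
        ‖a‖ ^ 2 := by
      refine hasSum_le (fun n => ?_) hpa hasq
      rw [norm_mul, norm_pow, Complex.norm_real, Real.norm_of_nonneg hr0]
      gcongr
      exact mul_le_of_le_one_right (norm_nonneg _) (pow_le_one₀ hr0 hr1.le)
    refine h1.trans ((pow_le_pow_left₀ (norm_nonneg _) hle 2).trans ?_)
    rw [mul_pow, mul_pow]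
    gcongr
  have key1 : ∀ N : ℕ, ∑ n ∈ Finset.range N, ‖b n‖ ^ 2 ≤ (C * ‖a‖) ^ 2 := by
    intro N
    have hlim : Filter.Tendsto (fun r : ℝ => ∑ n ∈ Finset.range N, ‖b n‖ ^ 2 * (r ^ n) ^ 2)
        (nhdsWithin 1 (Set.Iio 1)) (nhds (∑ n ∈ Finset.range N, ‖b n‖ ^ 2 * (1 ^ n) ^ 2)) :=
      ((by fun_prop : Continuous fun r : ℝ => ∑ n ∈ Finset.range N,
        ‖b n‖ ^ 2 * (r ^ n) ^ 2).tendsto 1).mono_left nhdsWithin_le_nhds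
    have h : ∀ᶠ r : ℝ in nhdsWithin 1 (Set.Iio 1),
        ∑ n ∈ Finset.range N, ‖b n‖ ^ 2 * (r ^ n) ^ 2 ≤ (C * ‖a‖) ^ 2 := by
      filter_upwards [Ioo_mem_nhdsLT (show (0 : ℝ) < 1 from one_pos)] with r hr
      exact key r hr.1.le hr.2 N
    simpa using le_of_tendsto hlim h
  have hmem : Memℓp b 2 := by
    refine memℓp_gen ?_
    have := summable_of_sum_range_le (fun n => sq_nonneg ‖b n‖) key1
    simpa using this
  refine ⟨⟨b, hmem⟩, ?_, ?_⟩
  · ext z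
    exact (hbs z z.norm_lt_one).tsum_eq
  · have hbsq : HasSum (fun n => ‖b n‖ ^ 2) (‖(⟨b, hmem⟩ : lp (fun _ : ℕ => ℂ) 2)‖ ^ 2) := by
      have := lp.hasSum_norm (p := 2) (by norm_num) (⟨b, hmem⟩ : lp (fun _ : ℕ => ℂ) 2)
      simpa using this
    refine le_of_sq_le_sq ?_ (by positivity)
    exact le_of_tendsto' hbsq.tendsto_sum_nat key1

/-- The multiplication operator `M_φ f = φ f` on `H²(𝔻)`. -/
def mulOp {φ : ℂ → ℂ} (hφ : IsBoundedAnalytic φ) : HardySpace →L[ℂ] HardySpace :=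
  LinearMap.mkContinuousOfExistsBound
    { toFun := fun f => ⟨fun z => φ z * f z, by
        obtain ⟨C, hC⟩ := hφ.bounded
        obtain ⟨b, hb, -⟩ := exists_mul_coeff hφ.analytic hC (HardySpace.coeffEquiv f)
        rw [HardySpace.powerSeriesMap_coeffEquiv] at hb
        exact ⟨b, hb⟩⟩
      map_add' := fun f g => Subtype.ext (funext fun z => mul_add (φ z) (f z) (g z))
      map_smul' := fun c f => Subtype.ext (funext fun z => mul_left_comm (φ z) c (f z)) }
    (by
      obtain ⟨C, hC⟩ := hφ.bounded
      refine ⟨C, fun f => ?_⟩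
      obtain ⟨b, hb, hn⟩ := exists_mul_coeff hφ.analytic hC (HardySpace.coeffEquiv f)
      rw [HardySpace.powerSeriesMap_coeffEquiv] at hb
      refine le_trans (le_of_eq ?_) hn
      rw [HardySpace.norm_def]
      congr 1
      apply powerSeriesMap_injective
      rw [HardySpace.powerSeriesMap_coeffEquiv, hb]
      rfl)

theorem mulOp_apply {φ : ℂ → ℂ} (hφ : IsBoundedAnalytic φ) (f : HardySpace) (z : 𝔻) :
    mulOp hφ f z = φ z * f z := rfl

end

/-! Sufficiency comes from unimodular eigenvectors. The kernels satisfy M_φ^* k_u = conj(φ(conj u))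
k_u, with k_u = `kernel u` holomorphic in u, and S ↦ R S T sends the rank one operator x ⊗ y : f ↦
⟪y, f⟫ x to Rx ⊗ T^*y. So if |φ(z)ψ(w)| = 1, the kernels at z and w give a rank one eigenvector with
the unimodular eigenvalue conj(φ(z)) ψ(w). Since one symbol is non-constant, that eigenvalue can be
moved along an arc of the circle, with eigenvectors f(t) depending smoothly on t and eigenvalues c
e^{2πit}. For a smooth cutoff χ the integrals Y_n = c^n ∫ e^{2πint} χ(t) f(t) dt form a two-sided
orbit, absolutely summable because Fourier transforms of C² functions decay quadratically
(`integral_mem_summableOrbits`).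

Such orbits suffice (`frequentlyHypercyclic_of_dense_summableOrbits`): on a separable Banach space,
if the vectors Y_0 are dense, one superposes orbits shifted to well separated sets of times of
positive lower density (`exists_separated_sets`). At a time scheduled for a given vector its own
orbit contributes Y_0, and the other orbits contribute only small tails. Density in the compact
operators reduces to rank one operators, and by the identity theorem the kernels available near one
unimodular point already span densely.

The other two spaces are reached by intertwining maps with dense range. For COT this is the
inclusion of the compact operators. For the Schatten classes it is S ↦ D_r S, with D_r the dilation
f ↦ f(r·): it lies in every S_p, has dense range, and satisfies M_φ^* D_r = D_r M_{φ(r·)}^*. Taking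
r close to 1 keeps the unimodular value. Nothing about S_p as a Banach space is needed.

For necessity, |φ(z)ψ(w)| is continuous on the connected bidisc, so if it avoids 1 it stays on one
side of 1. As ‖M_φ‖ ≤ sup |φ|, either S ↦ M_φ^* S M_ψ or its inverse is then contractive for the
operator norm, and no orbit is dense (`norm_monotone_of_no_unimodular`,
`FrequentlyHypercyclic.not_norm_monotone`). -/

noncomputable section

/-! ### Lower density -/

theorem lowerDensity_pos_of_injective {A : Set ℕ} {q : ℕ → ℕ} (hq : Function.Injective q) {C : ℕ}
    (hC : 0 < C) (h : ∀ s, q s ∈ A ∧ 1 ≤ q s ∧ q s ≤ C * (s + 1)) : 0 < lowerDensity A := by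
  have hcard : ∀ N : ℕ, N / C ≤ (A ∩ Set.Icc 1 N).ncard := by
    intro N
    have hsub : q '' (Finset.range (N / C) : Set ℕ) ⊆ A ∩ Set.Icc 1 N := by
      rintro _ ⟨s, hs, rfl⟩
      obtain ⟨h1, h2, h3⟩ := h s
      refine ⟨h1, h2, h3.trans ?_⟩
      have hs' : s + 1 ≤ N / C := Finset.mem_range.1 (Finset.mem_coe.1 hs)
      exact (Nat.mul_le_mul_left C hs').trans (Nat.mul_div_le N C)
    have := Set.ncard_le_ncard hsub ((Set.finite_Icc 1 N).subset Set.inter_subset_right)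
    rwa [Set.ncard_image_of_injective _ hq, Set.ncard_coe_finset, Finset.card_range] at this
  -- A real `liminf` can be bounded below only for a sequence that does not escape to infinity; the
  -- trivial bound 1 provides this.
  have hub : ∀ N : ℕ, ((A ∩ Set.Icc 1 N).ncard : ℝ) / N ≤ 1 := by
    intro N
    refine div_le_one_of_le₀ ?_ (Nat.cast_nonneg _)
    have := Set.ncard_le_ncard (Set.inter_subset_right (s := A)) (Set.finite_Icc 1 N)
    rw [← Finset.coe_Icc, Set.ncard_coe_finset, Nat.card_Icc] at this
    rw [← Finset.coe_Icc]
    exact_mod_cast this.trans (by omega)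
  have hlow : ∀ᶠ N : ℕ in Filter.atTop,
      (1 / (2 * C) : ℝ) ≤ ((A ∩ Set.Icc 1 N).ncard : ℝ) / N := by
    filter_upwards [Filter.eventually_ge_atTop C] with N hN
    have hN0 : 0 < N := hC.trans_le hN
    have h1 : N ≤ 2 * C * (N / C) := by
      have h2 := Nat.div_add_mod N C
      have h3 := Nat.mod_lt N hC
      have h4 : C * 1 ≤ C * (N / C) := Nat.mul_le_mul_left C (Nat.div_pos hN hC)
      nlinarith
    rw [div_le_div_iff₀ (by positivity) (by positivity), one_mul, mul_comm]
    exact_mod_cast h1.trans (Nat.mul_le_mul_left _ (hcard N))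
  refine lt_of_lt_of_le (by positivity : (0 : ℝ) < 1 / (2 * C))
    (Filter.le_liminf_of_le ?_ hlow)
  exact (Filter.isBoundedUnder_of ⟨1, hub⟩).isCoboundedUnder_ge

theorem lowerDensity_empty : lowerDensity ∅ = 0 := by
  simp [lowerDensity]

/-- Sets of positive lower density whose elements are separated by prescribed gaps. -/
theorem exists_separated_sets (N : ℕ → ℕ) :
    ∃ A : ℕ → Set ℕ, (∀ j B, A j ⊆ B → 0 < lowerDensity B) ∧ (∀ j, ∀ n ∈ A j, N j ≤ n) ∧
      ∀ i j, ∀ n ∈ A i, ∀ m ∈ A j, (i, n) ≠ (j, m) →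
        (N i : ℤ) ≤ |(m : ℤ) - n| ∧ (N j : ℤ) ≤ |(m : ℤ) - n| := by
  -- Class j will occupy the integers of 2-adic valuation exactly K j. The growth of K gives 2^j N_j
  -- ≤ 2^(K j), so the gaps demanded by class j cost at most 2^(-j) per unit of time on average.
  set K : ℕ → ℕ := fun j => ∑ i ∈ Finset.range (j + 1), (N i + 1) with hK
  have hKmono : StrictMono K := strictMono_nat_of_lt_succ fun j => by
    simp only [hK]
    rw [Finset.sum_range_succ _ (j + 1)]
    omega
  have hKN : ∀ j, j + N j ≤ K j := by
    intro j
    have h1 : j ≤ ∑ i ∈ Finset.range j, (N i + 1) := by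
      simpa using Finset.card_nsmul_le_sum (Finset.range j) (fun i => N i + 1) 1 (by simp)
    simp only [hK]
    rw [Finset.sum_range_succ]
    omega
  have hpow : ∀ j, 2 ^ j * N j ≤ 2 ^ K j := fun j =>
    calc 2 ^ j * N j ≤ 2 ^ j * 2 ^ N j := Nat.mul_le_mul_left _ Nat.lt_two_pow_self.le
      _ = 2 ^ (j + N j) := (pow_add _ _ _).symm
      _ ≤ 2 ^ K j := Nat.pow_le_pow_right two_pos (hKN j)
  have hjlt : ∀ j, j < 2 ^ K j := fun j =>
    Nat.lt_two_pow_self.trans_le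
      (Nat.pow_le_pow_right two_pos ((Nat.le_add_right _ _).trans (hKN j)))
  -- Weight of the slot t. Cutting the sum at j < t loses nothing for t > 0, since 2^(K j) ∣ t
  -- forces j < t, and it makes w 0 = 0 although every power divides 0.
  set w : ℕ → ℕ := fun t => ∑ j ∈ Finset.range t, if 2 ^ K j ∣ t then N j else 0 with hw
  have hwN : ∀ j t, 0 < t → 2 ^ K j ∣ t → N j ≤ w t := by
    intro j t ht hd
    have hjt : j ∈ Finset.range t := Finset.mem_range.2 ((hjlt j).trans_le (Nat.le_of_dvd ht hd))
    refine le_trans ?_ (Finset.single_le_sum (fun _ _ => Nat.zero_le _) hjt)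
    rw [if_pos hd]
  have hsum : ∀ t, ∑ s ∈ Finset.range (t + 1), w s ≤ 2 * t := by
    intro t
    have h1 : ∑ s ∈ Finset.range (t + 1), w s = ∑ s ∈ Finset.Ioc 0 t, w s := by
      rw [Finset.range_eq_Ico, Finset.sum_eq_sum_Ico_succ_bot (Nat.succ_pos t)]
      simp only [hw, Finset.range_zero, Finset.sum_empty, zero_add]
      refine Finset.sum_congr ?_ fun _ _ => rfl
      ext s
      simp only [Finset.mem_Ico, Finset.mem_Ioc]
      omega
    have h2 : ∑ s ∈ Finset.Ioc 0 t, w s ≤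
        ∑ s ∈ Finset.Ioc 0 t, ∑ j ∈ Finset.range t, if 2 ^ K j ∣ s then N j else 0 := by
      refine Finset.sum_le_sum fun s hs => Finset.sum_le_sum_of_subset ?_
      exact Finset.range_subset_range.2 (Finset.mem_Ioc.1 hs).2
    rw [Finset.sum_comm] at h2
    have h3 : ∀ j, (∑ s ∈ Finset.Ioc 0 t, if 2 ^ K j ∣ s then N j else 0) =
        t / 2 ^ K j * N j := by
      intro j
      rw [← Finset.sum_filter, Finset.sum_const, Nat.Ioc_filter_dvd_card_eq_div, smul_eq_mul]
    rw [h1]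
    refine h2.trans ?_
    simp only [h3]
    have h4 : (∑ j ∈ Finset.range t, ((t / 2 ^ K j * N j : ℕ) : ℝ)) ≤
        ∑ j ∈ Finset.range t, (t : ℝ) * (1 / 2) ^ j := by
      refine Finset.sum_le_sum fun j _ => ?_
      have h5 : t / 2 ^ K j * N j * 2 ^ j ≤ t := by
        calc t / 2 ^ K j * N j * 2 ^ j = t / 2 ^ K j * (2 ^ j * N j) := by ring
          _ ≤ t / 2 ^ K j * 2 ^ K j := Nat.mul_le_mul_left _ (hpow j)
          _ ≤ t := Nat.div_mul_le_self _ _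
      rw [one_div, inv_pow, ← div_eq_mul_inv, le_div_iff₀ (by positivity)]
      exact_mod_cast h5
    rw [← Finset.mul_sum] at h4
    have h6 := h4.trans (mul_le_mul_of_nonneg_left (sum_geometric_two_le t) (Nat.cast_nonneg t))
    rw [mul_comm]
    exact_mod_cast h6
  -- The slots are spread out so that slot t has free room w t on both sides. As w has mean at most
  -- 2, p grows linearly and positive density survives.
  set p : ℕ → ℕ := fun t => t + 2 * ∑ s ∈ Finset.range t, w s + w t with hp
  have hp5 : ∀ t, p t ≤ 5 * t := by
    intro t
    have := hsum t
    rw [Finset.sum_range_succ] at this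
    simp only [hp]
    omega
  have hgap : ∀ s t, s < t → p s + w s + w t < p t := by
    intro s t hst
    have h1 : ∑ i ∈ Finset.range (s + 1), w i ≤ ∑ i ∈ Finset.range t, w i :=
      Finset.sum_le_sum_of_subset (Finset.range_subset_range.2 hst)
    rw [Finset.sum_range_succ] at h1
    simp only [hp]
    omega
  have hpmono : StrictMono p := fun s t hst => by have := hgap s t hst; omega
  set b : ℕ → ℕ → ℕ := fun j s => 2 ^ K j * (2 * s + 1) with hb
  have hbpos : ∀ j s, 0 < b j s := fun j s => Nat.mul_pos (by positivity) (by omega)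
  have hbinj : ∀ j, Function.Injective (b j) := fun j s s' h => by
    have := Nat.eq_of_mul_eq_mul_left (by positivity : 0 < 2 ^ K j) h
    omega
  have hbw : ∀ j s, N j ≤ w (b j s) := fun j s => hwN j _ (hbpos j s) (Dvd.intro _ rfl)
  have hbdisj : ∀ i j s t, b i s = b j t → i = j := by
    have key : ∀ i j s t, i < j → b i s ≠ b j t := by
      intro i j s t hij h
      have h1 : 2 ^ (K i + 1) ∣ b i s := by
        rw [h]
        exact (pow_dvd_pow 2 (hKmono hij)).trans (Dvd.intro _ rfl)
      rw [pow_succ] at h1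
      have h2 := Nat.dvd_of_mul_dvd_mul_left (by positivity) h1
      omega
    intro i j s t h
    rcases lt_trichotomy i j with h1 | h1 | h1
    · exact absurd h (key _ _ _ _ h1)
    · exact h1
    · exact absurd h.symm (key _ _ _ _ h1)
  refine ⟨fun j => Set.range fun s => p (b j s), ?_, ?_, ?_⟩
  · intro j B hB
    refine lowerDensity_pos_of_injective (hpmono.injective.comp (hbinj j)) (C := 10 * 2 ^ K j)
      (by positivity) fun s => ⟨hB ⟨s, rfl⟩, ?_, ?_⟩
    · exact (hbpos j s).trans_le (hpmono.le_apply)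
    · refine (hp5 _).trans ?_
      simp only [hb]
      nlinarith [Nat.pos_of_ne_zero (pow_ne_zero (K j) (two_ne_zero : (2 : ℕ) ≠ 0))]
  · rintro j _ ⟨s, rfl⟩
    refine (hbw j s).trans ?_
    simp only [hp]
    omega
  · rintro i j _ ⟨s, rfl⟩ _ ⟨t, rfl⟩ hne
    dsimp only at hne ⊢
    have h1 := hbw i s
    have h2 := hbw j t
    rcases lt_trichotomy (b i s) (b j t) with h | h | h
    · have h3 := hgap _ _ h
      rw [abs_of_nonneg (by omega)]
      constructor <;> omega
    · obtain rfl := hbdisj _ _ _ _ h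
      exact absurd (by rw [h]) hne
    · have h3 := hgap _ _ h
      rw [abs_of_nonpos (by omega)]
      constructor <;> omega

/-! ### A frequent hypercyclicity criterion -/

theorem FrequentlyHypercyclic.exists_iterate_mem {X : Type*} [AddCommGroup X] [Module ℂ X]
    [TopologicalSpace X] {T : X →L[ℂ] X} (hT : FrequentlyHypercyclic T) :
    ∃ x : X, ∀ U : Set X, IsOpen U → U.Nonempty → ∃ n : ℕ, (⇑T)^[n] x ∈ U := by
  obtain ⟨x, hx⟩ := hT
  refine ⟨x, fun U hU hne => ?_⟩
  by_contra! h
  have := hx U hU hne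
  rw [show {n : ℕ | (⇑T)^[n] x ∈ U} = ∅ from Set.eq_empty_of_forall_notMem h,
    lowerDensity_empty] at this
  exact this.false

theorem FrequentlyHypercyclic.of_intertwining {X Y : Type*} [AddCommGroup X] [Module ℂ X]
    [TopologicalSpace X] [AddCommGroup Y] [Module ℂ Y] [TopologicalSpace Y] {T : X →L[ℂ] X}
    {S : Y →L[ℂ] Y} (hT : FrequentlyHypercyclic T) {J : X → Y} (hJ : Continuous J)
    (hd : DenseRange J) (hJT : ∀ x, J (T x) = S (J x)) : FrequentlyHypercyclic S := by
  obtain ⟨x, hx⟩ := hT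
  refine ⟨J x, fun U hU hne => ?_⟩
  have h := hx (J ⁻¹' U) (hU.preimage hJ) (hd.exists_mem_open hU hne)
  have hit : ∀ n : ℕ, (⇑S)^[n] (J x) = J ((⇑T)^[n] x) := fun n =>
    (Function.Semiconj.iterate_right (f := J) (fun x => hJT x) n x).symm
  simp only [hit]
  exact h

section Criterion

variable {X : Type*} [NormedAddCommGroup X] [NormedSpace ℂ X]

/-- The vectors `y` lying on a two-sided orbit of `T` with summable norms. -/
def summableOrbits (T : X →L[ℂ] X) : Submodule ℂ X where
  carrier := {y | ∃ Y : ℤ → X, Y 0 = y ∧ (∀ n, T (Y n) = Y (n + 1)) ∧ Summable fun n => ‖Y n‖}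
  zero_mem' := ⟨0, rfl, by simp, by simp [summable_zero]⟩
  add_mem' := by
    rintro _ _ ⟨Y, rfl, hY, hYs⟩ ⟨Z, rfl, hZ, hZs⟩
    refine ⟨Y + Z, rfl, fun n => by simp [hY, hZ], ?_⟩
    exact Summable.of_nonneg_of_le (fun _ => norm_nonneg _) (fun n => norm_add_le _ _)
      (hYs.add hZs)
  smul_mem' := by
    rintro c _ ⟨Y, rfl, hY, hYs⟩
    refine ⟨c • Y, rfl, fun n => by simp [hY], ?_⟩
    simpa [norm_smul] using hYs.mul_left ‖c‖

/-- The map L is not assumed linear because it is also applied to y ↦ x ⊗ y, which is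
conjugate-linear. -/
theorem summableOrbits_map {Z : Type*} [NormedAddCommGroup Z] [NormedSpace ℂ Z]
    {T : X →L[ℂ] X} {S : Z →L[ℂ] Z} {L : X → Z} {C : ℝ} (hL : ∀ x, ‖L x‖ ≤ C * ‖x‖)
    (hLT : ∀ x, S (L x) = L (T x)) {x : X} (hx : x ∈ summableOrbits T) :
    L x ∈ summableOrbits S := by
  obtain ⟨Y, rfl, hY, hYs⟩ := hx
  exact ⟨fun n => L (Y n), rfl, fun n => by rw [hLT, hY],
    Summable.of_nonneg_of_le (fun _ => norm_nonneg _) (fun n => hL _) (hYs.mul_left C)⟩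

theorem tendsto_tsum_tail {Z : Type*} [NormedAddCommGroup Z] {Y : ℤ → Z} (hY : Summable fun n => ‖Y n‖) :
    Filter.Tendsto (fun N : ℕ => ∑' k : ℤ, if (N : ℤ) ≤ |k| then ‖Y k‖ₑ else 0)
      Filter.atTop (nhds 0) := by
  have hfin : ∑' k, ‖Y k‖ₑ ≠ ⊤ := by
    have := hY.tsum_ofReal_ne_top
    simpa using this
  rw [ENNReal.tendsto_atTop_zero]
  intro ε hε
  have h := ENNReal.tendsto_tsum_compl_atTop_zero hfin
  obtain ⟨s, hs⟩ := (h.eventually (ge_mem_nhds hε)).exists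
  -- Beyond this N no index with |k| ≥ N belongs to s, so the tail is dominated by the sum off s.
  refine ⟨s.sup (fun k : ℤ => k.natAbs + 1), fun N hN => le_trans ?_ hs⟩
  refine le_of_le_of_eq ?_ (tsum_subtype {x | x ∉ s} (fun k => ‖Y k‖ₑ)).symm
  refine ENNReal.tsum_le_tsum fun k => ?_
  split_ifs with hk
  · have : k ∉ s := fun hks => by
      rw [Int.abs_eq_natAbs] at hk
      have h1 : k.natAbs + 1 ≤ _ := Finset.le_sup (f := fun k : ℤ => k.natAbs + 1) hks
      omega
    rw [Set.indicator_of_mem this]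
  · exact zero_le

/-- A frequent hypercyclicity criterion in terms of two-sided summable orbits. -/
theorem frequentlyHypercyclic_of_dense_summableOrbits [CompleteSpace X]
    [TopologicalSpace.SeparableSpace X] {T : X →L[ℂ] X}
    (hT : Dense (summableOrbits T : Set X)) : FrequentlyHypercyclic T := by
  have : SecondCountableTopology X := UniformSpace.secondCountable_of_separable X
  set d : ℕ → summableOrbits T := TopologicalSpace.denseSeq (summableOrbits T) with hd
  have hdd : DenseRange fun n => (d n : X) :=
    (hT.denseRange_val).comp (TopologicalSpace.denseRange_denseSeq _) continuous_subtype_val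
  -- Unpairing l repeats each dense vector for infinitely many l, so each is approximated with
  -- arbitrarily small error.
  have hex : ∀ l : ℕ, ∃ Y : ℤ → X, Y 0 = d l.unpair.1 ∧ (∀ n, T (Y n) = Y (n + 1)) ∧
      Summable fun n => ‖Y n‖ := fun l => (d l.unpair.1).2
  choose Y hY0 hYT hYs using hex
  set τ : ℕ → ℕ → ENNReal := fun j N => ∑' k : ℤ, if (N : ℤ) ≤ |k| then ‖Y j k‖ₑ else 0 with hτ
  set a : ENNReal := 2⁻¹ with ha
  have ha1 : a < 1 := by rw [ha, ENNReal.inv_lt_one]; exact ENNReal.one_lt_two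
  have ha0 : a ≠ 0 := by simp [ha]
  -- N l controls only the finitely many orbits j ≤ l. This is enough, because times of classes l
  -- and j are separated by both N l and N j, hence by N (max l j).
  have hex : ∀ l : ℕ, ∃ N : ℕ, ∀ j ∈ Finset.range (l + 1), τ j N ≤ a ^ l * a ^ l := by
    intro l
    refine Filter.Eventually.exists (f := Filter.atTop) ?_
    rw [Filter.eventually_all_finset]
    intro j _
    exact (tendsto_tsum_tail (hYs j)).eventually (ge_mem_nhds (by positivity))
  choose N hN using hex
  obtain ⟨A, hAd, hAN, hAs⟩ := exists_separated_sets N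
  have hmax : ∀ l j, τ j (N (max l j)) ≤ a ^ l * a ^ j := by
    intro l j
    refine (hN _ j (Finset.mem_range.2 (Nat.lt_succ_of_le (le_max_right _ _)))).trans ?_
    exact mul_le_mul' (pow_le_pow_right_of_le_one' ha1.le (le_max_left _ _))
      (pow_le_pow_right_of_le_one' ha1.le (le_max_right _ _))
  -- At time m the copy of orbit j started at n contributes Y_j(m - n). These indices are distinct
  -- for distinct n, so the copies with |m - n| ≥ M add up to at most one tail of Y_j.
  have hrow : ∀ (j M : ℕ) (m : ℤ) (P : ℕ → Prop) (g : ℕ → X),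
      (∀ n, P n → g n = Y j (m - n) ∧ (M : ℤ) ≤ |m - n|) → (∀ n, ¬ P n → g n = 0) →
      ∑' n, ‖g n‖ₑ ≤ τ j M := by
    intro j M m P g hP hP'
    have hinj : Function.Injective fun n : ℕ => m - (n : ℤ) := fun n n' h => by
      simp only [sub_right_inj, Nat.cast_inj] at h
      exact h
    refine le_trans (ENNReal.tsum_le_tsum fun n => ?_) (ENNReal.tsum_comp_le_tsum_of_injective hinj
      (fun k : ℤ => if (M : ℤ) ≤ |k| then ‖Y j k‖ₑ else 0))
    by_cases h : P n
    · rw [(hP n h).1, if_pos (hP n h).2]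
    · simp [hP' n h]
  classical
  -- The frequently hypercyclic vector is ∑ g 0, and ∑ g m is its m-th iterate.
  set g : ℕ → ℕ × ℕ → X := fun m q => if q.2 ∈ A q.1 then Y q.1 ((m : ℤ) - q.2) else 0 with hg
  have hgs : Summable (g 0) := by
    refine Summable.of_norm ?_
    have : ∑' q, ‖g 0 q‖ₑ ≠ ⊤ := by
      rw [ENNReal.tsum_prod']
      refine ne_top_of_le_ne_top ?_ (ENNReal.tsum_le_tsum (g := fun j => a ^ j) fun j => ?_)
      · rw [ENNReal.tsum_geometric]
        simp [tsub_eq_zero_iff_le, ha1]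
      · refine (hrow j (N (max j j)) 0 (fun n => n ∈ A j) _ (fun n hn => ⟨?_, ?_⟩)
          (fun n hn => ?_)).trans ((hmax j j).trans ?_)
        · simp [hg, hn]
        · have := hAN j n hn
          rw [max_self, zero_sub, abs_neg, Nat.abs_cast]
          exact_mod_cast this
        · simp [hg, hn]
        · exact mul_le_of_le_one_left' (pow_le_one' ha1.le j)
    have h2 := (ENNReal.tsum_coe_ne_top_iff_summable (f := fun q => ‖g 0 q‖₊)).1 this
    exact NNReal.summable_coe.2 h2
  have hgT : ∀ m q, T (g m q) = g (m + 1) q := by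
    intro m q
    simp only [hg]
    split_ifs
    · rw [hYT]
      congr 1
      push_cast
      ring
    · simp
  have hgm : ∀ m, Summable (g m) ∧ (⇑T)^[m] (∑' q, g 0 q) = ∑' q, g m q := by
    intro m
    induction m with
    | zero => exact ⟨hgs, rfl⟩
    | succ m ih =>
      have h1 : g (m + 1) = fun q => T (g m q) := funext fun q => (hgT m q).symm
      refine ⟨?_, ?_⟩
      · rw [h1]; exact T.summable ih.1
      · rw [Function.iterate_succ_apply', ih.2, T.map_tsum ih.1, h1]
  have hmain : ∀ l, ∀ m ∈ A l, ‖(⇑T)^[m] (∑' q, g 0 q) - d l.unpair.1‖ₑ ≤ a ^ l * 2 := by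
    intro l m hm
    have hlm : g m (l, m) = d l.unpair.1 := by simp [hg, hm, hY0]
    -- The term (l, m) is the target vector itself; all remaining terms are error.
    rw [(hgm m).2, (hgm m).1.tsum_eq_add_tsum_ite (l, m), hlm, add_sub_cancel_left]
    refine enorm_tsum_le_tsum_enorm.trans ?_
    rw [ENNReal.tsum_prod']
    have h2 : (2 : ENNReal) = ∑' j, a ^ j := by
      rw [ENNReal.tsum_geometric, ha, ENNReal.one_sub_inv_two, inv_inv]
    rw [h2, ← ENNReal.tsum_mul_left]
    refine ENNReal.tsum_le_tsum fun j => (hrow j (N (max l j)) m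
      (fun n => n ∈ A j ∧ (j, n) ≠ (l, m)) _ (fun n hn => ⟨?_, ?_⟩) (fun n hn => ?_)).trans
      (hmax l j)
    · rw [if_neg hn.2]
      simp [hg, hn.1]
    · have := hAs j l n hn.1 m hm hn.2
      rcases max_choice l j with h | h <;> rw [h]
      · exact this.2
      · exact this.1
    · by_cases h : (j, n) = (l, m)
      · rw [if_pos h]
      · rw [if_neg h]
        have : n ∉ A j := fun h' => hn ⟨h', h⟩
        simp [hg, this]
  refine ⟨∑' q, g 0 q, fun U hU hne => ?_⟩
  obtain ⟨i, hi⟩ := hdd.exists_mem_open hU hne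
  obtain ⟨ε, hε, hball⟩ := Metric.isOpen_iff.1 hU _ hi
  have hlim : Filter.Tendsto (fun k : ℕ => a ^ k * 2) Filter.atTop (nhds (0 * 2)) :=
    ENNReal.Tendsto.mul_const (ENNReal.tendsto_pow_atTop_nhds_zero_of_lt_one ha1) (by simp)
  rw [zero_mul] at hlim
  obtain ⟨k, hk⟩ := (hlim.eventually
    (gt_mem_nhds (ENNReal.ofReal_pos.2 hε))).exists
  -- The class `Nat.pair i k` targets the i-th dense vector and has index at least k, so its error
  -- is at most 2 · 2^(-k) < ε.
  refine hAd (Nat.pair i k) _ fun m hm => hball ?_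
  have h1 := hmain _ m hm
  rw [Nat.unpair_pair] at h1
  rw [mem_ball_iff_norm]
  have h3 : ‖(⇑T)^[m] (∑' q, g 0 q) - (d i : X)‖ₑ < ENNReal.ofReal ε := by
    refine h1.trans_lt (lt_of_le_of_lt ?_ hk)
    gcongr 1
    exact pow_le_pow_right_of_le_one' ha1.le (Nat.right_le_pair i k)
  rw [← ofReal_norm] at h3
  exact (ENNReal.ofReal_lt_ofReal_iff hε).1 h3

end Criterion

/-! ### Smooth curves of unimodular eigenvectors -/

section Curves

open scoped FourierTransform

variable {H : Type*} [NormedAddCommGroup H] [NormedSpace ℂ H]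

/-- The transform of f'' is bounded by its L¹ norm and equals (2πix)² times that of f, which gives
decay like n^(-2). -/
theorem summable_norm_fourier_int {f : ℝ → H} (hf : ContDiff ℝ 2 f) (hc : HasCompactSupport f) :
    Summable fun n : ℤ => ‖𝓕 f (-(n : ℝ))‖ := by
  have hint : ∀ n : ℕ, (n : ℕ∞) ≤ (2 : ℕ∞) → MeasureTheory.Integrable (iteratedDeriv n f) := by
    intro n hn
    refine Continuous.integrable_of_hasCompactSupport
      (hf.continuous_iteratedDeriv n (by exact_mod_cast hn)) ?_
    refine hc.mono' ?_
    have : iteratedDeriv n f = fun x => (iteratedFDeriv ℝ n f x) fun _ => (1 : ℝ) := rfl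
    refine fun x hx => support_iteratedFDeriv_subset (𝕜 := ℝ) (n := n) ?_
    intro h0
    exact hx (by rw [this]; simp [h0])
  have h2 := Real.fourier_iteratedDeriv (N := 2) (n := 2) hf hint le_rfl
  set M : ℝ := ∫ v, ‖iteratedDeriv 2 f v‖ with hM
  have hb : ∀ x : ℝ, ‖𝓕 (iteratedDeriv 2 f) x‖ ≤ M := fun x =>
    VectorFourier.norm_fourierIntegral_le_integral_norm _ _ _ _ _
  have hs : Summable fun n : ℤ => (M / (2 * Real.pi) ^ 2) * (1 / (n : ℝ) ^ 2) :=
    (Real.summable_one_div_int_pow.2 one_lt_two).mul_left _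
  refine Summable.of_norm_bounded_eventually hs ?_
  rw [Filter.eventually_cofinite]
  refine (Set.finite_singleton (0 : ℤ)).subset fun n hn => ?_
  by_contra hn0
  refine hn ?_
  have hn0' : (n : ℝ) ≠ 0 := by exact_mod_cast hn0
  have h3 := hb (-(n : ℝ))
  rw [h2] at h3
  simp only [norm_smul, norm_pow, norm_mul, Complex.norm_ofNat, Complex.norm_I, Complex.norm_real,
    norm_neg, Real.norm_eq_abs, mul_pow, sq_abs] at h3
  rw [norm_norm, div_mul_div_comm, mul_one, le_div_iff₀ (by positivity)]
  nlinarith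

theorem integral_mem_summableOrbits [CompleteSpace H] {S : H →L[ℂ] H} {f : ℝ → H}
    (hf : ContDiff ℝ 2 f) (hc : HasCompactSupport f) {c : ℂ} (hc1 : ‖c‖ = 1)
    (hS : ∀ t, S (f t) = (c * Real.fourierChar t) • f t) : ∫ t, f t ∈ summableOrbits S := by
  have hc0 : c ≠ 0 := fun h => by simp [h] at hc1
  -- The n-th vector is ∫ (c e^{2πit})^n f(t) dt, so applying S raises the exponent by one.
  refine ⟨fun n => c ^ n • 𝓕 f (-(n : ℝ)), ?_, fun n => ?_, ?_⟩
  · change c ^ (0 : ℤ) • 𝓕 f (-((0 : ℤ) : ℝ)) = _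
    rw [Real.fourier_real_eq]
    simp
  · have hint : MeasureTheory.Integrable fun v : ℝ => Real.fourierChar (-(v * -(n : ℝ))) • f v :=
      Continuous.integrable_of_hasCompactSupport (by have := hf.continuous; fun_prop)
        (hc.smul_left)
    change S (c ^ n • 𝓕 f (-(n : ℝ))) = c ^ (n + 1) • 𝓕 f (-((n + 1 : ℤ) : ℝ))
    rw [map_smul, Real.fourier_real_eq, Real.fourier_real_eq, ← S.integral_comp_comm hint,
      zpow_add_one₀ hc0, mul_smul, ← MeasureTheory.integral_smul c]
    congr 2
    ext v
    rw [Circle.smul_def, map_smul, hS, Circle.smul_def, smul_smul, smul_smul]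
    congr 1
    have : -(v * -((n + 1 : ℤ) : ℝ)) = -(v * -(n : ℝ)) + v := by push_cast; ring
    rw [this, AddChar.map_add_eq_mul, Circle.coe_mul]
    ring
  · simpa [norm_smul, hc1] using summable_norm_fourier_int hf hc

end Curves

/-! ### Level sets of analytic functions on the disc -/

section Level

variable {G : ℂ → ℂ}

/-- Critical points of a non-constant G are isolated and G is open, so a slight rotation of the
value G(u₀) is attained at a nearby non-critical point. -/
theorem exists_unimodular_deriv_ne_zero (hG : AnalyticOnNhd ℂ G (Metric.ball 0 1)) {u₀ v : ℂ}
    (hu₀ : u₀ ∈ Metric.ball (0 : ℂ) 1) (hv : v ∈ Metric.ball (0 : ℂ) 1) (hne : G u₀ ≠ G v)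
    (h1 : ‖G u₀‖ = 1) : ∃ u ∈ Metric.ball (0 : ℂ) 1, ‖G u‖ = 1 ∧ deriv G u ≠ 0 := by
  have hball : Metric.ball (0 : ℂ) 1 ∈ nhds u₀ := Metric.isOpen_ball.mem_nhds hu₀
  have hpre : IsPreconnected (Metric.ball (0 : ℂ) 1) := (convex_ball 0 1).isPreconnected
  rcases (hG.deriv u₀ hu₀).eventually_eq_zero_or_eventually_ne_zero with h | h
  · refine absurd ?_ hne
    have h0 := hG.deriv.eqOn_zero_of_preconnected_of_eventuallyEq_zero hpre hu₀ h
    exact Metric.isOpen_ball.is_const_of_deriv_eq_zero hpre hG.differentiableOn h0 hu₀ hv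
  rcases (hG u₀ hu₀).eventually_constant_or_nhds_le_map_nhds with h' | h'
  · exfalso
    have hd : ∀ᶠ z in nhdsWithin u₀ {u₀}ᶜ, deriv G z = 0 := by
      refine Filter.Eventually.filter_mono nhdsWithin_le_nhds ?_
      filter_upwards [h'.eventually_nhds] with z hz
      have : G =ᶠ[nhds z] fun _ => G u₀ := hz
      rw [this.deriv_eq, deriv_const]
    obtain ⟨z, hz⟩ := (h.and hd).exists
    exact hz.1 hz.2
  have hV : {u | u ∈ Metric.ball (0 : ℂ) 1 ∧ (u ≠ u₀ → deriv G u ≠ 0)} ∈ nhds u₀ :=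
    Filter.inter_mem hball (eventually_nhdsWithin_iff.1 h)
  have hGV := h' (Filter.image_mem_map hV)
  have hcurve : Filter.Tendsto (fun t : ℝ => G u₀ * Complex.exp (t * Complex.I))
      (nhdsWithin 0 (Set.Ioi 0)) (nhds (G u₀)) := by
    have : Continuous fun t : ℝ => G u₀ * Complex.exp (t * Complex.I) := by fun_prop
    simpa using (this.tendsto 0).mono_left nhdsWithin_le_nhds
  -- Requiring 0 < t < π makes sin t ≠ 0, so the rotated value differs from G(u₀) and the preimage u
  -- from u₀.
  obtain ⟨t, ⟨u, ⟨hu1, hu2⟩, hu3⟩, ht⟩ := ((hcurve.eventually hGV).and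
    (Ioo_mem_nhdsGT Real.pi_pos)).exists
  refine ⟨u, hu1, ?_, hu2 ?_⟩
  · rw [hu3, norm_mul, h1, Complex.norm_exp_ofReal_mul_I, one_mul]
  · rintro rfl
    have hG0 : G u ≠ 0 := fun h0 => by simp [h0] at h1
    have h2 : Complex.exp (t * Complex.I) = 1 := mul_left_cancel₀ hG0 (by rw [← hu3, mul_one])
    have h3 := congrArg Complex.im h2
    rw [Complex.exp_ofReal_mul_I_im, Complex.one_im] at h3
    exact (Real.sin_pos_of_mem_Ioo ht).ne' h3

/-- The local inverse of G at a non-critical point is composed with the circular arc through G(u).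
-/
theorem exists_unimodular_curve (hG : AnalyticOnNhd ℂ G (Metric.ball 0 1)) {u : ℂ}
    (hu : u ∈ Metric.ball (0 : ℂ) 1) (hd : deriv G u ≠ 0) :
    ∃ (γ : ℝ → ℂ) (δ : ℝ), 0 < δ ∧ γ 0 = u ∧ ∀ t ∈ Set.Ioo (-δ) δ, ContDiffAt ℝ 2 γ t ∧
      γ t ∈ Metric.ball (0 : ℂ) 1 ∧ G (γ t) = G u * Real.fourierChar t := by
  have hcd : ContDiffAt ℂ 2 G u := (hG u hu).contDiffAt
  have hfd : HasFDerivAt G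
      ((ContinuousLinearEquiv.unitsEquivAut ℂ (Units.mk0 _ hd) : ℂ ≃L[ℂ] ℂ) : ℂ →L[ℂ] ℂ) u :=
    (hG u hu).differentiableAt.hasDerivAt.hasFDerivAt_equiv hd
  have h20 : (2 : WithTop ℕ∞) ≠ 0 := two_ne_zero
  set g := hcd.localInverse hfd h20 with hg
  have hgu : g (G u) = u := hcd.localInverse_apply_image hfd h20
  have hgcd : ContDiffAt ℂ 2 g (G u) := hcd.to_localInverse hfd h20
  have hright : ∀ᶠ y in nhds (G u), G (g y) = y :=
    (hcd.hasStrictFDerivAt' hfd h20).eventually_right_inverse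
  set e : ℝ → ℂ := fun t => G u * Real.fourierChar t with he
  have hecd : ContDiff ℝ 2 e := by
    simp only [he, Real.fourierChar_apply]
    refine contDiff_const.mul (ContDiff.cexp (ContDiff.mul ?_ contDiff_const))
    exact Complex.ofRealCLM.contDiff.comp (contDiff_const.mul contDiff_id)
  have he0 : e 0 = G u := by simp [he]
  have hcd0 : ContDiffAt ℝ 2 (g ∘ e) 0 := by
    refine ContDiffAt.comp 0 ?_ hecd.contDiffAt
    rw [he0]
    exact hgcd.restrict_scalars ℝ
  have h1 : ∀ᶠ t in nhds (0 : ℝ), ContDiffAt ℝ 2 (g ∘ e) t := hcd0.eventually (by decide)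
  have h2 : ∀ᶠ t in nhds (0 : ℝ), G (g (e t)) = e t := by
    have := hecd.continuous.tendsto 0
    rw [he0] at this
    exact this.eventually hright
  have h3 : ∀ᶠ t in nhds (0 : ℝ), (g ∘ e) t ∈ Metric.ball (0 : ℂ) 1 := by
    refine hcd0.continuousAt.eventually (Metric.isOpen_ball.mem_nhds ?_)
    simpa [he0, hgu] using hu
  obtain ⟨δ, hδ, h⟩ := Metric.eventually_nhds_iff.1 (h1.and (h2.and h3))
  refine ⟨g ∘ e, δ, hδ, by simp [he0, hgu], fun t ht => ?_⟩
  obtain ⟨a, b, c⟩ := h (y := t) (by rw [Real.dist_eq, sub_zero]; exact abs_lt.2 ht)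
  exact ⟨a, c, b⟩

end Level

/-! ### Reproducing kernels of the Hardy space -/

namespace HardySpace

/-- The extension of `f ∈ H²(𝔻)` by its power series. -/
def series (f : HardySpace) (z : ℂ) : ℂ := ∑' n : ℕ, coeffEquiv f n * z ^ n

theorem series_coe (f : HardySpace) (z : 𝔻) : series f z = f z :=
  congrFun (powerSeriesMap_coeffEquiv f) z

theorem analyticOnNhd_series (f : HardySpace) :
    AnalyticOnNhd ℂ (series f) (Metric.ball 0 1) := by
  have := (powerSeries_hasFPowerSeriesOnBall (coeffEquiv f)).analyticOnNhd
  rwa [← ENNReal.ofReal_one, Metric.eball_ofReal] at this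

theorem eq_zero_of_frequently {f : HardySpace} {z : ℂ} (hz : z ∈ Metric.ball (0 : ℂ) 1)
    (h : ∃ᶠ w in nhdsWithin z {z}ᶜ, series f w = 0) : f = 0 := by
  have h0 := (analyticOnNhd_series f).eqOn_zero_of_preconnected_of_frequently_eq_zero
    (convex_ball 0 1).isPreconnected hz h
  refine Subtype.ext (funext fun w => ?_)
  have := h0 (mem_ball_zero_iff.2 w.norm_lt_one)
  rw [series_coe] at this
  exact this

/-- The monomial `zⁿ`. -/
def monomial (n : ℕ) : HardySpace := coeffIsometry.symm (lp.single 2 n (1 : ℂ))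

theorem norm_monomial (n : ℕ) : ‖monomial n‖ = 1 := by
  rw [monomial, LinearIsometryEquiv.norm_map, lp.norm_single (by norm_num), norm_one]

theorem inner_monomial (n : ℕ) (f : HardySpace) : ⟪monomial n, f⟫_ℂ = coeffEquiv f n := by
  rw [monomial, ← LinearIsometryEquiv.inner_map_map coeffIsometry,
    LinearIsometryEquiv.apply_symm_apply, lp.inner_single_left]
  simp
  rfl

/-- The reproducing kernel at `conj u`, as a holomorphic function of `u`. -/
def kernel (u : ℂ) : HardySpace := ∑' n : ℕ, u ^ n • monomial n

theorem summable_kernel {u : ℂ} (hu : ‖u‖ < 1) : Summable fun n : ℕ => u ^ n • monomial n := by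
  refine Summable.of_norm ?_
  simpa [norm_smul, norm_monomial] using summable_geometric_of_lt_one (norm_nonneg u) hu

theorem inner_kernel {u : ℂ} (hu : ‖u‖ < 1) (f : HardySpace) :
    ⟪kernel u, f⟫_ℂ = series f (starRingEnd ℂ u) := by
  rw [← inner_conj_symm, ← innerSL_apply_apply ℂ, kernel,
    ContinuousLinearMap.map_tsum _ (summable_kernel hu), Complex.conj_tsum]
  refine tsum_congr fun n => ?_
  rw [innerSL_apply_apply, inner_smul_right, map_mul, inner_conj_symm, inner_monomial, map_pow,
    mul_comm]

theorem inner_kernel_conj (z : 𝔻) (f : HardySpace) :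
    ⟪kernel (starRingEnd ℂ (z : ℂ)), f⟫_ℂ = f z := by
  rw [inner_kernel (by simpa using z.norm_lt_one), Complex.conj_conj, series_coe]

theorem differentiableOn_kernel : DifferentiableOn ℂ kernel (Metric.ball 0 1) := by
  intro u hu
  have hu' : ‖u‖ < 1 := mem_ball_zero_iff.1 hu
  obtain ⟨r, hr, hr1⟩ := exists_between hu'
  have h := Complex.differentiableOn_tsum_of_summable_norm (U := Metric.ball (0 : ℂ) r)
    (F := fun n u => u ^ n • monomial n)
    (summable_geometric_of_lt_one ((norm_nonneg u).trans hr.le) hr1)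
    (fun n => by fun_prop) Metric.isOpen_ball (fun n w hw => by
      rw [norm_smul, norm_monomial, mul_one, norm_pow]
      exact pow_le_pow_left₀ (norm_nonneg _) (mem_ball_zero_iff.1 hw).le n)
  exact (h.differentiableAt
    (Metric.isOpen_ball.mem_nhds (mem_ball_zero_iff.2 hr))).differentiableWithinAt

/-- Pairing with f turns both sides into φ(conj u) f(conj u), by the reproducing property. -/
theorem adjoint_mulOp_kernel {φ : ℂ → ℂ} (hφ : IsBoundedAnalytic φ) {u : ℂ} (hu : ‖u‖ < 1) :
    ContinuousLinearMap.adjoint (mulOp hφ) (kernel u) =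
      starRingEnd ℂ (φ (starRingEnd ℂ u)) • kernel u := by
  refine ext_inner_right ℂ fun f => ?_
  have hz : u = starRingEnd ℂ ((star (Complex.UnitDisc.mk u hu) : 𝔻) : ℂ) := by simp
  rw [ContinuousLinearMap.adjoint_inner_left, inner_smul_left, Complex.conj_conj, hz,
    inner_kernel_conj, inner_kernel_conj, Complex.conj_conj, mulOp_apply]

theorem dense_span_kernel {W : Set 𝔻} (hW : ∀ f : HardySpace, (∀ w ∈ W, f w = 0) → f = 0) :
    Dense (Submodule.span ℂ ((fun w : 𝔻 => kernel (starRingEnd ℂ (w : ℂ))) '' W) :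
      Set HardySpace) := by
  rw [Submodule.dense_iff_topologicalClosure_eq_top, Submodule.topologicalClosure_eq_top_iff,
    Submodule.eq_bot_iff]
  intro f hf
  refine hW f fun w hw => ?_
  rw [← inner_kernel_conj]
  exact (Submodule.mem_orthogonal _ f).1 hf _ (Submodule.subset_span ⟨w, hw, rfl⟩)

end HardySpace

open HardySpace in
/-- Adjoint multipliers have a dense set of summable two-sided orbits as soon as they have a
unimodular eigenvalue of kernel type. -/
theorem dense_summableOrbits_adjoint_mulOp {φ : ℂ → ℂ} (hφ : IsBoundedAnalytic φ)
    (hnc : ∃ z w : 𝔻, φ z ≠ φ w) (c : ℂ) {z₀ : 𝔻} (h1 : ‖φ z₀ * c‖ = 1) :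
    Dense (summableOrbits (c • ContinuousLinearMap.adjoint (mulOp hφ)) : Set HardySpace) := by
  -- G(u) is the eigenvalue of c M_φ^* on `kernel u`; the two conjugations make it holomorphic.
  set G : ℂ → ℂ := fun u => c * starRingEnd ℂ (φ (starRingEnd ℂ u)) with hG
  have hGa : AnalyticOnNhd ℂ G (Metric.ball 0 1) := by
    refine DifferentiableOn.analyticOnNhd (fun u hu => ?_) Metric.isOpen_ball
    have hu' : starRingEnd ℂ u ∈ Metric.ball (0 : ℂ) 1 := by simpa using hu
    have := (hφ.analytic _ hu').differentiableAt.conj_conj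
    rw [Complex.conj_conj] at this
    exact (this.const_mul c).differentiableWithinAt
  have hmem : ∀ z : 𝔻, starRingEnd ℂ (z : ℂ) ∈ Metric.ball (0 : ℂ) 1 := fun z => by
    simpa using z.norm_lt_one
  have hGz : ∀ z : 𝔻, G (starRingEnd ℂ (z : ℂ)) = c * starRingEnd ℂ (φ z) := fun z => by simp [hG]
  have hc0 : c ≠ 0 := fun h => by simp [h] at h1
  obtain ⟨v, hv⟩ : ∃ v : 𝔻, φ z₀ ≠ φ v := by
    by_contra! h
    obtain ⟨z, w, hzw⟩ := hnc
    exact hzw ((h z).symm.trans (h w))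
  obtain ⟨u, hu, hGu, hdu⟩ := exists_unimodular_deriv_ne_zero hGa (hmem z₀) (hmem v)
    (by
      rw [hGz, hGz]
      intro h
      exact hv ((starRingEnd ℂ).injective (mul_left_cancel₀ hc0 h)))
    (by rw [hGz, norm_mul, RCLike.norm_conj, mul_comm, ← norm_mul, h1])
  obtain ⟨γ, δ, hδ, hγ0, hγ⟩ := exists_unimodular_curve hGa hu hdu
  have hKγ : ∀ t ∈ Set.Ioo (-δ) δ, ContDiffAt ℝ 2 (fun t => kernel (γ t)) t := by
    intro t ht
    obtain ⟨ha, hb, -⟩ := hγ t ht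
    have hK : ContDiffAt ℂ 2 kernel (γ t) :=
      (differentiableOn_kernel.analyticOnNhd Metric.isOpen_ball _ hb).contDiffAt
    exact ContDiffAt.comp t (hK.restrict_scalars ℝ) ha
  rw [Submodule.dense_iff_topologicalClosure_eq_top, Submodule.topologicalClosure_eq_top_iff,
    Submodule.eq_bot_iff]
  intro f hf
  -- A vector f orthogonal to all summable orbits annihilates ∫ χ(t) k_{γ(t)} dt for every test
  -- function χ, so its pairing with the curve vanishes almost everywhere.
  have hzero : ∀ᵐ t : ℝ, t ∈ Set.Ioo (-δ) δ → ⟪f, kernel (γ t)⟫_ℂ = 0 := by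
    have hcont : ContinuousOn (fun t => kernel (γ t)) (Set.Ioo (-δ) δ) := fun t ht =>
      (hKγ t ht).continuousAt.continuousWithinAt
    refine isOpen_Ioo.ae_eq_zero_of_integral_contDiff_smul_eq_zero
      ((continuousOn_const.inner hcont).locallyIntegrableOn measurableSet_Ioo) ?_
    intro χ hχ hχc hχs
    set F : ℝ → HardySpace := fun t => (χ t : ℝ) • kernel (γ t) with hF
    have hFc : HasCompactSupport F := hχc.smul_right
    have hFd : ContDiff ℝ 2 F := by
      refine contDiff_iff_contDiffAt.2 fun t => ?_
      by_cases ht : t ∈ tsupport F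
      swap
      · exact contDiffAt_const.congr_of_eventuallyEq (notMem_tsupport_iff_eventuallyEq.1 ht)
      have ht' := hχs (tsupport_smul_subset_left χ _ ht)
      exact ((hχ.of_le (by norm_cast)).contDiffAt).smul (hKγ t ht')
    have hmem := integral_mem_summableOrbits
      (S := c • ContinuousLinearMap.adjoint (mulOp hφ)) hFd hFc hGu (fun t => ?_)
    · have h0 := (Submodule.mem_orthogonal' _ f).1 hf _ hmem
      rw [← innerSL_apply_apply ℂ, ← ContinuousLinearMap.integral_comp_comm _
        (hFd.continuous.integrable_of_hasCompactSupport hFc)] at h0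
      rw [← h0]
      congr 1
      ext t
      simp only [hF, innerSL_apply_apply]
      rw [← Complex.coe_smul, ← Complex.coe_smul, inner_smul_right, smul_eq_mul]
    · by_cases ht : t ∈ Set.Ioo (-δ) δ
      · obtain ⟨-, hb, hGt⟩ := hγ t ht
        rw [← hGt]
        simp only [hF, hG]
        rw [← Complex.coe_smul, map_smul, smul_apply,
          adjoint_mulOp_kernel hφ (mem_ball_zero_iff.1 hb), smul_smul, smul_smul, smul_smul]
        congr 1
        ring
      · have : χ t = 0 := by
          by_contra h
          exact ht (hχs (subset_tsupport _ h))
        simp [hF, this]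
  have hfreq : ∃ᶠ t in nhdsWithin (0 : ℝ) {0}ᶜ, t ∈ Set.Ioo (-δ) δ ∧ ⟪f, kernel (γ t)⟫_ℂ = 0 := by
    have h2 : ∀ᶠ t in nhdsWithin (0 : ℝ) {0}ᶜ, t ∈ Set.Ioo (-δ) δ :=
      nhdsWithin_le_nhds (Ioo_mem_nhds (by linarith) hδ)
    refine Filter.Frequently.mono (Filter.Frequently.and_eventually
      (p := fun t => t ∈ Set.Ioo (-δ) δ → ⟪f, kernel (γ t)⟫_ℂ = 0) ?_ h2) fun t ht =>
      ⟨ht.2, ht.1 ht.2⟩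
    intro hev
    obtain ⟨ε, hε, hsub⟩ := Metric.mem_nhdsWithin_iff.1 hev
    have hnull : MeasureTheory.volume (Set.Ioo 0 ε) = 0 := by
      refine MeasureTheory.measure_mono_null (fun t ht => ?_) hzero
      exact hsub ⟨by rw [mem_ball_zero_iff, Real.norm_of_nonneg ht.1.le]; exact ht.2, ht.1.ne'⟩
    rw [Real.volume_Ioo, sub_zero, ENNReal.ofReal_eq_zero] at hnull
    exact hε.not_ge hnull
  have h00 : (0 : ℝ) ∈ Set.Ioo (-δ) δ := ⟨by linarith, hδ⟩
  -- The zeros conj(γ(t)) of f accumulate at conj(u), and the identity theorem applies once γ(t) ≠ u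
  -- for small t ≠ 0.
  refine eq_zero_of_frequently (z := starRingEnd ℂ u) (by simpa using hu) ?_
  have htend : Filter.Tendsto (fun t => starRingEnd ℂ (γ t)) (nhdsWithin 0 {0}ᶜ)
      (nhdsWithin (starRingEnd ℂ u) {starRingEnd ℂ u}ᶜ) := by
    refine tendsto_nhdsWithin_iff.2 ⟨?_, ?_⟩
    · have : ContinuousAt (fun t => starRingEnd ℂ (γ t)) 0 :=
        Complex.continuous_conj.continuousAt.comp (hγ 0 h00).1.continuousAt
      have h3 := this.tendsto.mono_left (nhdsWithin_le_nhds (s := {0}ᶜ))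
      rwa [hγ0] at h3
    · have h4 : ∀ᶠ t in nhdsWithin (0 : ℝ) {0}ᶜ, t ∈ Set.Ioo (-(min δ (1 / 2))) (min δ (1 / 2)) :=
        nhdsWithin_le_nhds (Ioo_mem_nhds (by simp [hδ]) (by simp [hδ]))
      filter_upwards [h4, self_mem_nhdsWithin] with t ht ht0 h5
      have h6 := (hγ t ⟨(neg_le_neg (min_le_left _ _)).trans_lt ht.1,
        ht.2.trans_le (min_le_left _ _)⟩).2.2
      rw [(starRingEnd ℂ).injective h5] at h6
      have hGu0 : G u ≠ 0 := fun h => by simp [h] at hGu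
      have h7 : ((Real.fourierChar t : Circle) : ℂ) = 1 :=
        (mul_left_cancel₀ hGu0 (by rw [← h6, mul_one]))
      rw [Real.fourierChar_apply, Complex.exp_eq_one_iff] at h7
      obtain ⟨n, hn⟩ := h7
      have h8 : t = n := by
        have h9 : ((2 * Real.pi * Complex.I : ℂ)) ≠ 0 := Complex.two_pi_I_ne_zero
        have : (2 * Real.pi * Complex.I : ℂ) * t = (2 * Real.pi * Complex.I) * n := by
          push_cast at hn
          linear_combination hn
        exact_mod_cast mul_left_cancel₀ h9 this
      have h10 : |t| < 1 := abs_lt.2 ⟨by linarith [ht.1, min_le_right δ (1 / 2)],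
        by linarith [ht.2, min_le_right δ (1 / 2)]⟩
      rw [h8] at h10
      have h11 : n = 0 := Int.abs_lt_one_iff.1 (by exact_mod_cast h10)
      exact ht0 (by simp [h8, h11])
  refine htend.frequently (hfreq.mono fun t ht => ?_)
  have h12 := (hγ t ht.1).2.1
  rw [← inner_kernel (mem_ball_zero_iff.1 h12), ← inner_conj_symm, ht.2, map_zero]

/-! ### Finite rank approximation -/

section FiniteRank

variable {H : Type*} [NormedAddCommGroup H] [InnerProductSpace ℂ H]

/-- V is spanned by a finite ε/2-net of C. The projection fixes the net and is contractive, so the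
error is at most twice the distance to the net. -/
theorem exists_starProjection_near {C : Set H} (hC : IsCompact C) {ε : ℝ} (hε : 0 < ε) :
    ∃ (V : Submodule ℂ H) (_ : FiniteDimensional ℂ V), ∀ x ∈ C, ‖V.starProjection x - x‖ ≤ ε := by
  obtain ⟨t, -, htf, htC⟩ := hC.finite_cover_balls (half_pos hε)
  have hfd : FiniteDimensional ℂ (Submodule.span ℂ t) := FiniteDimensional.span_of_finite ℂ htf
  refine ⟨Submodule.span ℂ t, hfd, fun x hx => ?_⟩
  obtain ⟨y, hy, hxy⟩ := Set.mem_iUnion₂.1 (htC hx)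
  have hPy := (Submodule.span ℂ t).starProjection_eq_self_iff.2 (Submodule.subset_span hy)
  have h1 : (Submodule.span ℂ t).starProjection x - x =
      (Submodule.span ℂ t).starProjection (x - y) - (x - y) := by
    rw [map_sub, hPy]
    abel
  have h2 := (Submodule.span ℂ t).starProjection.le_of_opNorm_le
    (Submodule.span ℂ t).starProjection_norm_le (x - y)
  rw [mem_ball_iff_norm] at hxy
  rw [h1]
  linarith [norm_sub_le ((Submodule.span ℂ t).starProjection (x - y)) (x - y)]

theorem isCompactOperator_rankOne (x y : H) :
    IsCompactOperator (InnerProductSpace.rankOne ℂ x y) := by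
  rw [InnerProductSpace.rankOne_def']
  exact (isCompactOperator_of_locallyCompactSpace_rng
    (ContinuousLinearMap.toSpanSingleton ℂ x)).comp_clm (innerSL ℂ y)

theorem isCompactOperator_starProjection (V : Submodule ℂ H) [FiniteDimensional ℂ V] :
    IsCompactOperator V.starProjection := by
  rw [(stdOrthonormalBasis ℂ V).starProjection_eq_sum_rankOne]
  exact Submodule.sum_mem (compactOperator (RingHom.id ℂ) H H)
    fun i _ => isCompactOperator_rankOne _ _

/-- The rank one operator `f ↦ ⟪y, f⟫ x` as a compact operator. -/
def compactRankOne (x y : H) : compactOperator (RingHom.id ℂ) H H :=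
  ⟨InnerProductSpace.rankOne ℂ x y, isCompactOperator_rankOne x y⟩

theorem norm_compactRankOne (x y : H) : ‖compactRankOne x y‖ = ‖x‖ * ‖y‖ :=
  InnerProductSpace.norm_rankOne x y

theorem compactRankOne_add_left (x x' y : H) :
    compactRankOne (x + x') y = compactRankOne x y + compactRankOne x' y :=
  Subtype.ext (by simp [compactRankOne])

theorem compactRankOne_smul_left (c : ℂ) (x y : H) :
    compactRankOne (c • x) y = c • compactRankOne x y :=
  Subtype.ext (by simp [compactRankOne])

theorem compactRankOne_add_right (x y y' : H) :
    compactRankOne x (y + y') = compactRankOne x y + compactRankOne x y' :=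
  Subtype.ext (by simp [compactRankOne])

theorem compactRankOne_smul_right (c : ℂ) (x y : H) :
    compactRankOne x (c • y) = starRingEnd ℂ c • compactRankOne x y :=
  Subtype.ext (by simp [compactRankOne])

theorem continuous_compactRankOne : Continuous fun q : H × H => compactRankOne q.1 q.2 := by
  refine Continuous.subtype_mk ?_ _
  exact (ContinuousLinearMap.smulRightL ℂ H H).continuous₂.comp
    (((innerSL ℂ).continuous.comp continuous_snd).prodMk continuous_fst)

theorem compactRankOne_mem_of_dense_left {Q : Submodule ℂ (compactOperator (RingHom.id ℂ) H H)}
    (hQ : IsClosed (Q : Set (compactOperator (RingHom.id ℂ) H H))) {s : Set H}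
    (hs : Dense (Submodule.span ℂ s : Set H)) {y : H} (h : ∀ x ∈ s, compactRankOne x y ∈ Q)
    (x : H) : compactRankOne x y ∈ Q := by
  have hc : IsClosed {x | compactRankOne x y ∈ Q} := hQ.preimage
    (continuous_compactRankOne.comp (Continuous.prodMk_left y))
  refine hc.closure_subset_iff.2 (fun z hz => ?_) (hs x)
  induction hz using Submodule.span_induction with
  | mem z hz => exact h z hz
  | zero =>
    rw [Set.mem_ofPred_eq, show compactRankOne 0 y = 0 from Subtype.ext (by simp [compactRankOne])]
    exact Q.zero_mem
  | add a b _ _ ha hb =>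
    rw [Set.mem_ofPred_eq, compactRankOne_add_left]
    exact Q.add_mem ha hb
  | smul c a _ ha =>
    rw [Set.mem_ofPred_eq, compactRankOne_smul_left]
    exact Q.smul_mem c ha

theorem compactRankOne_mem_of_dense_right {Q : Submodule ℂ (compactOperator (RingHom.id ℂ) H H)}
    (hQ : IsClosed (Q : Set (compactOperator (RingHom.id ℂ) H H))) {s : Set H}
    (hs : Dense (Submodule.span ℂ s : Set H)) {x : H} (h : ∀ y ∈ s, compactRankOne x y ∈ Q)
    (y : H) : compactRankOne x y ∈ Q := by
  have hc : IsClosed {y | compactRankOne x y ∈ Q} := hQ.preimage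
    (continuous_compactRankOne.comp (Continuous.prodMk_right x))
  refine hc.closure_subset_iff.2 (fun z hz => ?_) (hs y)
  induction hz using Submodule.span_induction with
  | mem z hz => exact h z hz
  | zero =>
    rw [Set.mem_ofPred_eq, show compactRankOne x 0 = 0 from Subtype.ext (by simp [compactRankOne])]
    exact Q.zero_mem
  | add a b _ _ ha hb =>
    rw [Set.mem_ofPred_eq, compactRankOne_add_right]
    exact Q.add_mem ha hb
  | smul c a _ ha =>
    rw [Set.mem_ofPred_eq, compactRankOne_smul_right]
    exact Q.smul_mem _ ha

variable [CompleteSpace H]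

theorem eq_top_of_compactRankOne_mem {Q : Submodule ℂ (compactOperator (RingHom.id ℂ) H H)}
    (hQ : IsClosed (Q : Set (compactOperator (RingHom.id ℂ) H H)))
    (h : ∀ x y, compactRankOne x y ∈ Q) : Q = ⊤ := by
  refine Submodule.eq_top_iff'.2 fun S => ?_
  refine hQ.closure_subset (Metric.mem_closure_iff.2 fun ε hε => ?_)
  obtain ⟨C, hC, hSC⟩ := IsCompactOperator.image_closedBall_subset_compact
    (f := ((S : H →L[ℂ] H) : H →ₗ[ℂ] H)) S.2 1
  obtain ⟨V, hV, hVC⟩ := exists_starProjection_near hC (half_pos hε)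
  set b := stdOrthonormalBasis ℂ V
  -- This sum is the projection onto V composed with S, and V nearly contains the image of the unit
  -- ball under S.
  refine ⟨∑ i, compactRankOne (b i : H) (ContinuousLinearMap.adjoint (S : H →L[ℂ] H) (b i)),
    Q.sum_mem fun i _ => h _ _, ?_⟩
  have hval : ((∑ i, compactRankOne (b i : H)
      (ContinuousLinearMap.adjoint (S : H →L[ℂ] H) (b i)) :
      compactOperator (RingHom.id ℂ) H H) : H →L[ℂ] H) = V.starProjection ∘L (S : H →L[ℂ] H) := by
    rw [b.starProjection_eq_sum_rankOne, AddSubmonoidClass.coe_finsetSum]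
    ext f
    simp [compactRankOne, ContinuousLinearMap.adjoint_inner_left]
  refine lt_of_le_of_lt ?_ (half_lt_self hε)
  rw [dist_comm, dist_eq_norm]
  change ‖((∑ i, compactRankOne (b i : H)
      (ContinuousLinearMap.adjoint (S : H →L[ℂ] H) (b i)) :
      compactOperator (RingHom.id ℂ) H H) : H →L[ℂ] H) - S‖ ≤ ε / 2
  rw [hval]
  refine ContinuousLinearMap.opNorm_le_of_unit_norm (half_pos hε).le fun x hx => ?_
  exact hVC _ (hSC ⟨x, by simp [hx], rfl⟩)

instance completeSpace_compactOperator :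
    CompleteSpace (compactOperator (RingHom.id ℂ) H H) :=
  (isClosed_setOfPred_isCompactOperator (σ₁₂ := RingHom.id ℂ) (M₁ := H)
    (M₂ := H)).completeSpace_coe

theorem separableSpace_compactOperator [TopologicalSpace.SeparableSpace H] :
    TopologicalSpace.SeparableSpace (compactOperator (RingHom.id ℂ) H H) := by
  rw [← TopologicalSpace.isSeparable_univ_iff]
  have hsep := (TopologicalSpace.isSeparable_range (continuous_compactRankOne (H := H))).span
    (R := ℂ)
  have htop := eq_top_of_compactRankOne_mem
    (Q := (Submodule.span ℂ
      (Set.range fun q : H × H => compactRankOne q.1 q.2)).topologicalClosure)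
    (Submodule.isClosed_topologicalClosure _) fun x y =>
      Submodule.le_topologicalClosure _ (Submodule.subset_span ⟨(x, y), rfl⟩)
  have h2 := hsep.closure
  rw [← Submodule.topologicalClosure_coe, htop] at h2
  exact h2

theorem conjCompact_compactRankOne (R T : H →L[ℂ] H) (x y : H) :
    conjCompact R T (compactRankOne x y) =
      compactRankOne (R x) (ContinuousLinearMap.adjoint T y) := by
  refine Subtype.ext ?_
  rw [conjCompact_apply]
  ext f
  simp [compactRankOne, ContinuousLinearMap.adjoint_inner_left]

/-- With y an eigenvector of T^*, the map x ↦ x ⊗ y carries orbits of cR to orbits of S ↦ R S T. The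
eigenvalue is written conj(c) because x ⊗ y is conjugate-linear in y. -/
theorem compactRankOne_mem_closure_left {R T : H →L[ℂ] H} {y : H} {c : ℂ}
    (hy : ContinuousLinearMap.adjoint T y = starRingEnd ℂ c • y)
    (hd : Dense (summableOrbits (c • R) : Set H)) (x : H) :
    compactRankOne x y ∈ (summableOrbits (conjCompact R T)).topologicalClosure := by
  refine compactRankOne_mem_of_dense_left (Submodule.isClosed_topologicalClosure _)
    (s := summableOrbits (c • R)) (by rwa [Submodule.span_eq]) (fun x hx => ?_) x
  refine Submodule.le_topologicalClosure _ (summableOrbits_map (L := fun x => compactRankOne x y)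
    (C := ‖y‖) (fun x => (norm_compactRankOne x y).le.trans_eq (mul_comm _ _)) (fun x => ?_) hx)
  rw [conjCompact_compactRankOne, hy, compactRankOne_smul_right, Complex.conj_conj,
    smul_apply, compactRankOne_smul_left]

theorem compactRankOne_mem_closure_right {R T : H →L[ℂ] H} {x : H} {c : ℂ}
    (hx : R x = starRingEnd ℂ c • x)
    (hd : Dense (summableOrbits (c • ContinuousLinearMap.adjoint T) : Set H)) (y : H) :
    compactRankOne x y ∈ (summableOrbits (conjCompact R T)).topologicalClosure := by
  refine compactRankOne_mem_of_dense_right (Submodule.isClosed_topologicalClosure _)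
    (s := summableOrbits (c • ContinuousLinearMap.adjoint T)) (by rwa [Submodule.span_eq])
    (fun y hy => ?_) y
  refine Submodule.le_topologicalClosure _ (summableOrbits_map (L := fun y => compactRankOne x y)
    (C := ‖x‖) (fun y => (norm_compactRankOne x y).le) (fun y => ?_) hy)
  rw [conjCompact_compactRankOne, hx, compactRankOne_smul_left, smul_apply,
    compactRankOne_smul_right]

/-- Frequent hypercyclicity passes from the compact operators to the bounded operators with the
topology of uniform convergence on compact sets. -/
theorem FrequentlyHypercyclic.conjCOT_of_conjCompact {R T : H →L[ℂ] H}
    (h : FrequentlyHypercyclic (conjCompact R T)) : FrequentlyHypercyclic (conjCOT R T) := by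
  set J : compactOperator (RingHom.id ℂ) H H →ₗ[ℂ] (H →L_c[ℂ] H) :=
    (ContinuousLinearMap.toUniformConvergenceCLM (RingHom.id ℂ) H
      {S : Set H | IsCompact S}).toLinearMap ∘ₗ
      (compactOperator (RingHom.id ℂ) H H).subtype with hJ
  have hJa : ∀ S x, J S x = (S : H →L[ℂ] H) x := fun S x => rfl
  refine h.of_intertwining (J := J) ?_ ?_ ?_
  · refine continuous_of_continuousAt_zero J ?_
    rw [ContinuousAt, map_zero, (CompactConvergenceCLM.hasBasis_nhds_zero_of_basis
      Metric.nhds_basis_ball).tendsto_right_iff]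
    rintro ⟨C, ε⟩ ⟨hC, hε⟩
    obtain ⟨r, hr, hCr⟩ := hC.isBounded.exists_pos_norm_le
    filter_upwards [Metric.ball_mem_nhds (0 : compactOperator (RingHom.id ℂ) H H)
      (div_pos hε hr)] with S hS x hx
    rw [mem_ball_zero_iff, lt_div_iff₀ hr] at hS
    rw [mem_ball_zero_iff, hJa]
    exact ((S : H →L[ℂ] H).le_of_opNorm_le_of_le le_rfl (hCr x hx)).trans_lt hS
  · intro S
    obtain ⟨S, rfl⟩ := (ContinuousLinearMap.toUniformConvergenceCLM (RingHom.id ℂ) H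
      {S : Set H | IsCompact S}).surjective S
    rw [mem_closure_iff_nhds]
    intro U hU
    rw [← map_add_left_nhds_zero, Filter.mem_map] at hU
    obtain ⟨⟨C, ε⟩, ⟨hC, hε⟩, hsub⟩ := (CompactConvergenceCLM.hasBasis_nhds_zero_of_basis
      Metric.nhds_basis_ball).mem_iff.1 hU
    -- S composed with the projection onto V has finite rank and is uniformly close to S on C; the
    -- denominator leaves room for ‖S‖ and handles S = 0.
    obtain ⟨V, hV, hVC⟩ := exists_starProjection_near hC
      (show 0 < ε / (2 * (‖S‖ + 1)) by positivity)
    refine ⟨_, ?_, ⟨⟨S ∘L V.starProjection,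
      (isCompactOperator_starProjection V).clm_comp S⟩, rfl⟩⟩
    set S' : compactOperator (RingHom.id ℂ) H H := ⟨S ∘L V.starProjection,
      (isCompactOperator_starProjection V).clm_comp S⟩
    have hmem : J S' - (ContinuousLinearMap.toUniformConvergenceCLM (RingHom.id ℂ) H
        {S : Set H | IsCompact S}) S ∈ (fun x => (ContinuousLinearMap.toUniformConvergenceCLM (RingHom.id ℂ) H
        {S : Set H | IsCompact S}) S + x) ⁻¹' U := by
      refine hsub fun x hx => ?_
      have h1 : (J S' - (ContinuousLinearMap.toUniformConvergenceCLM (RingHom.id ℂ) H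
        {S : Set H | IsCompact S}) S) x = S (V.starProjection x - x) := by
        rw [map_sub]
        rfl
      rw [mem_ball_zero_iff, h1]
      refine (S.le_of_opNorm_le_of_le le_rfl (hVC x hx)).trans_lt ?_
      rw [mul_div_assoc', div_lt_iff₀ (by positivity)]
      nlinarith [norm_nonneg S, mul_nonneg hε.le (norm_nonneg S)]
    simpa using hmem
  · intro S
    rfl

end FiniteRank

/-! ### Frequent hypercyclicity on the compact operators -/

/-- As w moves near w₀, the open map φ can solve φ(z) ψ(w) = φ(z₀) ψ(w₀) for z. -/
theorem exists_eventually_unimodular {φ ψ : ℂ → ℂ} (hφ : IsBoundedAnalytic φ)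
    (hψ : IsBoundedAnalytic ψ) (hnc : ∃ z w : 𝔻, φ z ≠ φ w) {z₀ w₀ : 𝔻}
    (h1 : ‖φ z₀ * ψ w₀‖ = 1) :
    ∀ᶠ w in nhds (w₀ : ℂ), ∃ z : 𝔻, ‖φ z * ψ w‖ = 1 := by
  have hmem : ∀ z : 𝔻, (z : ℂ) ∈ Metric.ball (0 : ℂ) 1 := fun z =>
    mem_ball_zero_iff.2 z.norm_lt_one
  have hψ0 : ψ w₀ ≠ 0 := fun h => by simp [h] at h1
  rcases (hφ.analytic z₀ (hmem z₀)).eventually_constant_or_nhds_le_map_nhds with h | h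
  · exfalso
    have := hφ.analytic.eqOn_of_preconnected_of_eventuallyEq (analyticOnNhd_const (v := φ z₀))
      (convex_ball 0 1).isPreconnected (hmem z₀) h
    obtain ⟨z, w, hzw⟩ := hnc
    exact hzw ((this (hmem z)).trans (this (hmem w)).symm)
  · have hc : ContinuousAt ψ w₀ := (hψ.analytic w₀ (hmem w₀)).continuousAt
    have hlim : Filter.Tendsto (fun w => φ z₀ * ψ w₀ / ψ w) (nhds (w₀ : ℂ)) (nhds (φ z₀)) := by
      have : ContinuousAt (fun w => φ z₀ * ψ w₀ / ψ w) (w₀ : ℂ) := continuousAt_const.div hc hψ0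
      have h2 := this.tendsto
      rwa [mul_div_cancel_right₀ _ hψ0] at h2
    have himg := h (Filter.image_mem_map (Metric.isOpen_ball.mem_nhds (hmem z₀)))
    filter_upwards [hlim.eventually himg, hc.eventually_ne hψ0] with w hw hw0
    obtain ⟨z, hz, hzw⟩ := hw
    refine ⟨Complex.UnitDisc.mk z (mem_ball_zero_iff.1 hz), ?_⟩
    rw [Complex.UnitDisc.coe_mk, hzw, div_mul_cancel₀ _ hw0, h1]

namespace HardySpace

theorem eq_zero_of_eventually {f : HardySpace} {w₀ : 𝔻} {P : ℂ → Prop}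
    (hP : ∀ᶠ w in nhds (w₀ : ℂ), P w) (h : ∀ w : 𝔻, P w → f w = 0) : f = 0 := by
  have hw₀ : (w₀ : ℂ) ∈ Metric.ball (0 : ℂ) 1 := mem_ball_zero_iff.2 w₀.norm_lt_one
  refine eq_zero_of_frequently hw₀ (Filter.Eventually.frequently ?_)
  refine Filter.Eventually.filter_mono nhdsWithin_le_nhds ?_
  filter_upwards [hP, Metric.isOpen_ball.mem_nhds hw₀] with w hw hw1
  have := h (Complex.UnitDisc.mk w (mem_ball_zero_iff.1 hw1)) hw
  rwa [← series_coe] at this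

theorem dense_span_monomial :
    Dense (Submodule.span ℂ (Set.range monomial) : Set HardySpace) := by
  rw [Submodule.dense_iff_topologicalClosure_eq_top, Submodule.topologicalClosure_eq_top_iff,
    Submodule.eq_bot_iff]
  intro f hf
  apply coeffEquiv.injective
  rw [map_zero]
  ext n
  rw [← inner_monomial]
  exact (Submodule.mem_orthogonal _ f).1 hf _ (Submodule.subset_span ⟨n, rfl⟩)

instance : TopologicalSpace.SeparableSpace HardySpace := by
  rw [← TopologicalSpace.isSeparable_univ_iff, ← dense_span_monomial.closure_eq]
  exact ((Set.countable_range monomial).isSeparable.span (R := ℂ)).closure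

end HardySpace

-- If φ is non-constant, fix w near w₀: the kernel at w is an eigenvector of M_ψ^*, and ψ(w) M_φ^*
-- has dense summable orbits. Hence x ⊗ k lies in the closure for every x and every such kernel k,
-- and these kernels span densely. If ψ is non-constant, the two factors exchange roles.
open HardySpace in
theorem frequentlyHypercyclic_conjCompact {φ ψ : ℂ → ℂ} (hφ : IsBoundedAnalytic φ)
    (hψ : IsBoundedAnalytic ψ) (hnc : (∃ z w : 𝔻, φ z ≠ φ w) ∨ (∃ z w : 𝔻, ψ z ≠ ψ w))
    (h1 : ∃ z w : 𝔻, ‖φ z * ψ w‖ = 1) :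
    FrequentlyHypercyclic
      (conjCompact (ContinuousLinearMap.adjoint (mulOp hφ)) (mulOp hψ)) := by
  have := separableSpace_compactOperator (H := HardySpace)
  obtain ⟨z₀, w₀, h1⟩ := h1
  refine frequentlyHypercyclic_of_dense_summableOrbits ?_
  rw [Submodule.dense_iff_topologicalClosure_eq_top]
  have hQ := Submodule.isClosed_topologicalClosure (summableOrbits
    (conjCompact (ContinuousLinearMap.adjoint (mulOp hφ)) (mulOp hψ)))
  have hlt : ∀ w : 𝔻, ‖starRingEnd ℂ (w : ℂ)‖ < 1 := fun w => by simpa using w.norm_lt_one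
  refine eq_top_of_compactRankOne_mem hQ fun x y => ?_
  rcases hnc with hnc | hnc
  · refine compactRankOne_mem_of_dense_right hQ (dense_span_kernel
      (W := {w | ∃ z : 𝔻, ‖φ z * ψ w‖ = 1}) fun f hf =>
        eq_zero_of_eventually (exists_eventually_unimodular hφ hψ hnc h1) hf) ?_ y
    rintro _ ⟨w, ⟨z, hz⟩, rfl⟩
    refine compactRankOne_mem_closure_left (c := ψ w) ?_
      (dense_summableOrbits_adjoint_mulOp hφ hnc (ψ w) hz) x
    rw [adjoint_mulOp_kernel hψ (hlt w), Complex.conj_conj]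
  · refine compactRankOne_mem_of_dense_left hQ (dense_span_kernel
      (W := {z | ∃ w : 𝔻, ‖ψ w * φ z‖ = 1}) fun f hf =>
        eq_zero_of_eventually (exists_eventually_unimodular hψ hφ hnc (mul_comm (φ z₀) _ ▸ h1))
          hf) ?_ x
    rintro _ ⟨z, ⟨w, hw⟩, rfl⟩
    refine compactRankOne_mem_closure_right (c := φ z) ?_
      (dense_summableOrbits_adjoint_mulOp hψ hnc (φ z) hw) y
    rw [adjoint_mulOp_kernel hφ (hlt z), Complex.conj_conj]

/-! ### Density of finite rank operators in the Schatten classes -/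

section SchattenDensity

variable {H : Type*} [NormedAddCommGroup H] [InnerProductSpace ℂ H]

theorem approxNumber_one (T : H →L[ℂ] H) : approxNumber T 1 = ‖T‖ := by
  refine le_antisymm ?_ (le_csInf ⟨_, 0, ?_, rfl⟩ ?_)
  · have h : ((0 : H →L[ℂ] H) : H →ₗ[ℂ] H).rank < ((1 : ℕ) : Cardinal) := by
      change (0 : H →ₗ[ℂ] H).rank < _
      rw [LinearMap.rank_zero]
      simp
    simpa using approxNumber_le (T := T) h
  · change (0 : H →ₗ[ℂ] H).rank < _
    rw [LinearMap.rank_zero]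
    simp
  · rintro r ⟨F, hF, rfl⟩
    rw [Nat.cast_one, Cardinal.lt_one_iff, LinearMap.rank, rank_zero_iff,
      Submodule.subsingleton_iff_eq_bot, LinearMap.range_eq_bot] at hF
    have : F = 0 := by
      ext x
      exact LinearMap.congr_fun hF x
    simp [this]

theorem approxNumber_antitone (T : H →L[ℂ] H) : Antitone fun n : ℕ => approxNumber T (n + 1) :=
  antitone_nat_of_succ_le (approxNumber_succ_le T)

theorem approxNumber_le_norm (T : H →L[ℂ] H) (n : ℕ) : approxNumber T (n + 1) ≤ ‖T‖ :=
  ((approxNumber_antitone T) (Nat.zero_le n)).trans_eq (approxNumber_one T)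

theorem approxNumber_neg (T : H →L[ℂ] H) (n : ℕ) :
    approxNumber (-T) (n + 1) = approxNumber T (n + 1) := by
  have key : ∀ S : H →L[ℂ] H, approxNumber (-S) (n + 1) ≤ approxNumber S (n + 1) := by
    intro S
    have h := approxNumber_comp_le (-ContinuousLinearMap.id ℂ H) S (ContinuousLinearMap.id ℂ H) n
    have e : (-ContinuousLinearMap.id ℂ H) ∘L S ∘L ContinuousLinearMap.id ℂ H = -S := by
      ext x
      simp
    rw [e, norm_neg] at h
    have hid := ContinuousLinearMap.norm_id_le (𝕜 := ℂ) (E := H)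
    exact h.trans (mul_le_of_le_one_left (approxNumber_nonneg _ _)
      (mul_le_one₀ hid (norm_nonneg _) hid))
  exact le_antisymm (key T) (by simpa using key (-T))

theorem approxNumber_succ_of_rank_lt {F : H →L[ℂ] H} {n : ℕ}
    (hF : (F : H →ₗ[ℂ] H).rank < ((n + 1 : ℕ) : Cardinal)) : approxNumber F (n + 1) = 0 :=
  le_antisymm (by simpa using approxNumber_le (T := F) hF) (approxNumber_nonneg _ _)

/-- The sum of the `p`-th powers of the approximation numbers of `T - F` for `F` of rank at most
`n`. -/
theorem tsum_approxNumber_sub_le {p : ℝ} (hp : 1 ≤ p) {T F : H →L[ℂ] H}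
    (hT : Summable fun k : ℕ => approxNumber T (k + 1) ^ p) {n : ℕ}
    (hF : (F : H →ₗ[ℂ] H).rank < ((n + 1 : ℕ) : Cardinal)) :
    ∑' k : ℕ, approxNumber (T - F) (k + 1) ^ p ≤
      2 * n * ‖T - F‖ ^ p + ∑' k : ℕ, approxNumber T (k + n + 1) ^ p := by
  have hp0 : 0 ≤ p := by linarith
  -- Subtracting an operator of rank at most n shifts approximation numbers by at most n. The first
  -- 2n terms are left to the crude bound by ‖T - F‖.
  have htail : ∀ k : ℕ, approxNumber (T - F) (k + 2 * n + 1) ^ p ≤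
      approxNumber T (k + n + 1) ^ p := by
    intro k
    refine Real.rpow_le_rpow (approxNumber_nonneg _ _) ?_ hp0
    have h := approxNumber_add_le T (-F) (k + n) n
    rw [approxNumber_neg, approxNumber_succ_of_rank_lt hF, add_zero, ← sub_eq_add_neg] at h
    rwa [two_mul, ← add_assoc]
  have hTn : Summable fun k : ℕ => approxNumber T (k + n + 1) ^ p :=
    (summable_nat_add_iff (f := fun k : ℕ => approxNumber T (k + 1) ^ p) n).2 hT
  have hs : Summable fun k : ℕ => approxNumber (T - F) (k + 2 * n + 1) ^ p :=
    Summable.of_nonneg_of_le (fun k => Real.rpow_nonneg (approxNumber_nonneg _ _) _) htail hTn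
  have hs' : Summable fun k : ℕ => approxNumber (T - F) (k + 1) ^ p :=
    (summable_nat_add_iff (f := fun k : ℕ => approxNumber (T - F) (k + 1) ^ p) (2 * n)).1 hs
  rw [← hs'.sum_add_tsum_nat_add (2 * n)]
  refine add_le_add ?_ (hs.tsum_le_tsum htail hTn)
  refine (Finset.sum_le_card_nsmul _ _ (‖T - F‖ ^ p) fun k _ =>
    Real.rpow_le_rpow (approxNumber_nonneg _ _) (approxNumber_le_norm _ _) hp0).trans_eq ?_
  rw [Finset.card_range, nsmul_eq_mul]
  push_cast
  ring

/-- The m terms with indices m, …, 2m - 1 all dominate q(2m). This makes the crude first block of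
`tsum_approxNumber_sub_le` small. -/
theorem Antitone.mul_le_tsum_tail {q : ℕ → ℝ} (hq : Antitone q) (h0 : ∀ n, 0 ≤ q n)
    (hs : Summable q) (m : ℕ) : m * q (2 * m) ≤ ∑' k, q (k + m) := by
  have hsm : Summable fun k => q (k + m) := (summable_nat_add_iff m).2 hs
  refine le_trans ?_ (hsm.sum_le_tsum (Finset.range m) fun k _ => h0 _)
  have := Finset.card_nsmul_le_sum (Finset.range m) (fun k => q (k + m)) (q (2 * m))
    fun k hk => hq (by have := Finset.mem_range.1 hk; omega)
  simpa using this

/-- Finite rank operators are approximated by operators of at most the same rank that factor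
through an operator with dense range. -/
theorem exists_comp_near_finiteRank {D F : H →L[ℂ] H} (hD : DenseRange D) {n : ℕ}
    (hF : (F : H →ₗ[ℂ] H).rank < (n : Cardinal)) {δ : ℝ} (hδ : 0 < δ) :
    ∃ G : H →L[ℂ] H, IsCompactOperator G ∧
      ((D ∘L G : H →L[ℂ] H) : H →ₗ[ℂ] H).rank < (n : Cardinal) ∧
      ‖F - D ∘L G‖ ≤ δ := by
  set V := LinearMap.range (F : H →ₗ[ℂ] H) with hV
  have hfd : FiniteDimensional ℂ V := by
    refine Module.rank_lt_aleph0_iff.1 ?_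
    exact hF.trans Cardinal.natCast_lt_aleph0
  set b := stdOrthonormalBasis ℂ V
  set N := Module.finrank ℂ V
  have hη : 0 < δ / ((N + 1) * (‖F‖ + 1)) := by positivity
  have hex : ∀ i, ∃ x, ‖D x - (b i : H)‖ < δ / ((N + 1) * (‖F‖ + 1)) := fun i => by
    obtain ⟨x, hx⟩ := hD.exists_dist_lt (b i : H) hη
    exact ⟨x, by rwa [← dist_eq_norm, dist_comm]⟩
  choose x hx using hex
  -- D Q moves each basis vector b_i of the range of F to the nearby D x_i. Precomposing with F
  -- keeps the rank from growing.
  set Q : H →L[ℂ] H := ∑ i, InnerProductSpace.rankOne ℂ (x i) (b i : H) with hQ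
  have hQc : IsCompactOperator Q := Submodule.sum_mem (compactOperator (RingHom.id ℂ) H H)
    fun i _ => isCompactOperator_rankOne _ _
  refine ⟨Q ∘L F, hQc.comp_clm F, ?_, ?_⟩
  · exact lt_of_le_of_lt (LinearMap.rank_comp_le_right (F : H →ₗ[ℂ] H)
      ((D ∘L Q : H →L[ℂ] H) : H →ₗ[ℂ] H)) hF
  · have hPF : V.starProjection ∘L F = F := by
      ext f
      exact V.starProjection_eq_self_iff.2 ⟨f, rfl⟩
    have hDQ : D ∘L Q = ∑ i, InnerProductSpace.rankOne ℂ (D (x i)) (b i : H) := by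
      ext f
      simp [hQ]
    have hdiff : ‖V.starProjection - D ∘L Q‖ ≤ N * (δ / ((N + 1) * (‖F‖ + 1))) := by
      rw [hDQ, b.starProjection_eq_sum_rankOne, ← Finset.sum_sub_distrib]
      refine (norm_sum_le_of_le (n := fun _ => δ / ((N + 1) * (‖F‖ + 1))) _
        fun i _ => ?_).trans_eq ?_
      · rw [← sub_apply, ← map_sub, InnerProductSpace.norm_rankOne, norm_sub_rev]
        have : ‖(b i : H)‖ = 1 := b.norm_eq_one i
        rw [this, mul_one]
        exact (hx i).le
      · simp [N]
    have e : F - D ∘L (Q ∘L F) = (V.starProjection - D ∘L Q) ∘L F := by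
      rw [ContinuousLinearMap.sub_comp, hPF]
      rfl
    rw [e]
    refine (ContinuousLinearMap.opNorm_comp_le _ _).trans
      ((mul_le_mul_of_nonneg_right hdiff (norm_nonneg _)).trans ?_)
    rw [mul_div_assoc', div_mul_eq_mul_div, div_le_iff₀ (by positivity)]
    have : (0 : ℝ) ≤ N := Nat.cast_nonneg _
    nlinarith [mul_nonneg hδ.le (norm_nonneg F), mul_nonneg hδ.le this,
      mul_nonneg (mul_nonneg hδ.le this) (norm_nonneg F)]

theorem exists_comp_near_schatten {p : ℝ} (hp : 1 ≤ p) {D T : H →L[ℂ] H} (hD : DenseRange D)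
    (hT : Summable fun k : ℕ => approxNumber T (k + 1) ^ p) {ε : ℝ} (hε : 0 < ε) :
    ∃ G : H →L[ℂ] H, IsCompactOperator G ∧
      ∑' k : ℕ, approxNumber (T - D ∘L G) (k + 1) ^ p < ε := by
  have hp0 : 0 < p := by linarith
  set q : ℕ → ℝ := fun k => approxNumber T (k + 1) ^ p with hq
  have hq0 : ∀ k, 0 ≤ q k := fun k => Real.rpow_nonneg (approxNumber_nonneg _ _) _
  have hqa : Antitone q := fun m n hmn =>
    Real.rpow_le_rpow (approxNumber_nonneg _ _) (approxNumber_antitone T hmn) hp0.le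
  obtain ⟨m, hm⟩ := ((tendsto_sum_nat_add q).eventually
    (gt_mem_nhds (show 0 < ε / 6 by positivity))).exists
  have h1 := hqa.mul_le_tsum_tail hq0 hT m
  have h2 : ∑' k, q (k + 2 * m) ≤ ∑' k, q (k + m) :=
    Summable.tsum_le_tsum (fun k => hqa (by omega)) ((summable_nat_add_iff (2 * m)).2 hT)
      ((summable_nat_add_iff m).2 hT)
  have hlim : Filter.Tendsto
      (fun δ : ℝ => 2 * ((2 * m : ℕ) : ℝ) * (approxNumber T (2 * m + 1) + δ) ^ p)
      (nhdsWithin 0 (Set.Ioi 0))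
      (nhds (2 * ((2 * m : ℕ) : ℝ) * (approxNumber T (2 * m + 1) + 0) ^ p)) := by
    refine Filter.Tendsto.mono_left (Continuous.tendsto ?_ 0) nhdsWithin_le_nhds
    exact continuous_const.mul ((continuous_const.add continuous_id).rpow_const
      fun _ => Or.inr hp0.le)
  have hlt : 2 * ((2 * m : ℕ) : ℝ) * (approxNumber T (2 * m + 1) + 0) ^ p < 5 * (ε / 6) := by
    rw [add_zero]
    push_cast
    have : (m : ℝ) * approxNumber T (2 * m + 1) ^ p < ε / 6 := h1.trans_lt hm
    linarith
  obtain ⟨δ, hδ, hδ0⟩ := ((hlim.eventually (gt_mem_nhds hlt)).and self_mem_nhdsWithin).exists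
  obtain ⟨F, hF, hTF⟩ := exists_approx T (2 * m) (half_pos hδ0)
  obtain ⟨G, hG, hr, hFG⟩ := exists_comp_near_finiteRank hD hF (half_pos hδ0)
  refine ⟨G, hG, (tsum_approxNumber_sub_le hp hT hr).trans_lt ?_⟩
  have hn : ‖T - D ∘L G‖ ≤ approxNumber T (2 * m + 1) + δ := by
    have : T - D ∘L G = (T - F) + (F - D ∘L G) := by abel
    rw [this]
    linarith [norm_add_le (T - F) (F - D ∘L G)]
  have h3 : 2 * ((2 * m : ℕ) : ℝ) * ‖T - D ∘L G‖ ^ p ≤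
      2 * ((2 * m : ℕ) : ℝ) * (approxNumber T (2 * m + 1) + δ) ^ p := by
    gcongr
  have h4 : ∑' k, approxNumber T (k + 2 * m + 1) ^ p < ε / 6 := h2.trans_lt hm
  linarith

/-- Frequent hypercyclicity passes from the compact operators to the Schatten classes along
`S ↦ D S`, if `D` has dense range and rapidly decreasing approximation numbers. -/
theorem FrequentlyHypercyclic.conjSchatten_of_conjCompact {p : ℝ} (hp : 1 ≤ p)
    {R R' T D : H →L[ℂ] H} (hD : DenseRange D)
    (hDp : Summable fun n : ℕ => approxNumber D (n + 1) ^ p) (hRD : R ∘L D = D ∘L R')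
    (h : FrequentlyHypercyclic (conjCompact R' T)) :
    FrequentlyHypercyclic (conjSchatten p hp R T) := by
  have hp0 : 0 < p := by linarith
  have hle : ∀ (S : H →L[ℂ] H) (n : ℕ),
      approxNumber (D ∘L S) (n + 1) ≤ ‖S‖ * approxNumber D (n + 1) := by
    intro S n
    have h := approxNumber_comp_le (ContinuousLinearMap.id ℂ H) D S n
    rw [ContinuousLinearMap.id_comp] at h
    refine h.trans (mul_le_mul_of_nonneg_right ?_ (approxNumber_nonneg _ _))
    exact mul_le_of_le_one_left (norm_nonneg _) ContinuousLinearMap.norm_id_le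
  have hle' : ∀ (S : H →L[ℂ] H) (n : ℕ),
      approxNumber (D ∘L S) (n + 1) ^ p ≤ ‖S‖ ^ p * approxNumber D (n + 1) ^ p := by
    intro S n
    rw [← Real.mul_rpow (norm_nonneg _) (approxNumber_nonneg _ _)]
    exact Real.rpow_le_rpow (approxNumber_nonneg _ _) (hle S n) hp0.le
  have hsum : ∀ S : H →L[ℂ] H, Summable fun n : ℕ => approxNumber (D ∘L S) (n + 1) ^ p :=
    fun S => Summable.of_nonneg_of_le (fun n => Real.rpow_nonneg (approxNumber_nonneg _ _) _)
      (hle' S) (hDp.mul_left _)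
  set J : compactOperator (RingHom.id ℂ) H H → SchattenClass H p hp :=
    fun S => ⟨D ∘L (S : H →L[ℂ] H), hsum S⟩ with hJ
  have hJa : ∀ S, SchattenClass.toCLM (J S) = D ∘L (S : H →L[ℂ] H) := fun S => rfl
  refine h.of_intertwining (J := J) (continuous_def.2 fun U hU => ?_) ?_ fun S => ?_
  · refine Metric.isOpen_iff.2 fun S hS => ?_
    obtain ⟨ε, hε, hεU⟩ := hU (J S) hS
    set A : ℝ := ∑' n : ℕ, approxNumber D (n + 1) ^ p with hA
    have hA0 : 0 ≤ A := tsum_nonneg fun n => Real.rpow_nonneg (approxNumber_nonneg _ _) _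
    refine ⟨ε / (A ^ (1 / p) + 1), by positivity, fun S' hS' => hεU (J S') ?_⟩
    set E : H →L[ℂ] H := (S' : H →L[ℂ] H) - S with hE
    have h1 : SchattenClass.toCLM (J S' - J S) = D ∘L E := by
      rw [map_sub, hJa, hJa, hE, ContinuousLinearMap.comp_sub]
    have h2 : ∑' n : ℕ, approxNumber (SchattenClass.toCLM (J S' - J S)) (n + 1) ^ p ≤
        ‖E‖ ^ p * A := by
      rw [h1, hA, ← tsum_mul_left]
      exact (hsum _).tsum_le_tsum (hle' _) (hDp.mul_left _)
    have h3 : SchattenClass.schattenNorm (J S' - J S) ≤ ‖E‖ * A ^ (1 / p) := by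
      refine (Real.rpow_le_rpow (tsum_nonneg fun n =>
        Real.rpow_nonneg (approxNumber_nonneg _ _) _) h2 (by positivity)).trans_eq ?_
      rw [Real.mul_rpow (by positivity) hA0, ← Real.rpow_mul (norm_nonneg _),
        mul_one_div_cancel hp0.ne', Real.rpow_one]
    have h4 : ‖E‖ < ε / (A ^ (1 / p) + 1) := mem_ball_iff_norm.1 hS'
    rw [lt_div_iff₀ (by positivity)] at h4
    nlinarith [norm_nonneg E]
  · refine dense_iff_inter_open.2 fun U hU ⟨T₀, hT₀⟩ => ?_
    obtain ⟨ε, hε, hεU⟩ := hU T₀ hT₀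
    obtain ⟨G, hG, hGε⟩ := exists_comp_near_schatten hp hD T₀.2
      (show 0 < ε ^ p by positivity)
    refine ⟨J ⟨G, hG⟩, hεU _ ?_, ⟨_, rfl⟩⟩
    have h1 : SchattenClass.toCLM (J ⟨G, hG⟩ - T₀) =
        -(SchattenClass.toCLM T₀ - D ∘L G) := by
      rw [map_sub, hJa, neg_sub]
    have h2 : SchattenClass.schattenNorm (J ⟨G, hG⟩ - T₀) < (ε ^ p) ^ (1 / p) := by
      refine Real.rpow_lt_rpow (tsum_nonneg fun n =>
        Real.rpow_nonneg (approxNumber_nonneg _ _) _) ?_ (by positivity)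
      rw [h1]
      simp only [approxNumber_neg]
      exact hGε
    rwa [← Real.rpow_mul hε.le, mul_one_div_cancel hp0.ne', Real.rpow_one] at h2
  · have : SchattenClass.toCLM (J (conjCompact R' T S)) =
        SchattenClass.toCLM (conjSchatten p hp R T (J S)) := by
      rw [conjSchatten_apply, hJa, hJa, conjCompact_apply, ← ContinuousLinearMap.comp_assoc,
        ← hRD]
      rfl
    exact Subtype.ext this

end SchattenDensity

/-! ### Dilations of the Hardy space -/

namespace HardySpace

theorem orthonormal_monomial : Orthonormal ℂ monomial := by
  refine orthonormal_iff_ite.2 fun m n => ?_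
  have h : coeffEquiv (monomial n) = lp.single 2 n (1 : ℂ) :=
    coeffIsometry.apply_symm_apply _
  rw [inner_monomial, h, lp.single_apply]
  by_cases hmn : m = n
  · subst hmn
    simp
  · simp [hmn]

/-- The dilation `f ↦ f(r ·)`, for `0 < r < 1`. -/
def dilation (r : ℝ) : HardySpace →L[ℂ] HardySpace :=
  ∑' n : ℕ, (r : ℂ) ^ n • InnerProductSpace.rankOne ℂ (monomial n) (monomial n)

variable {r : ℝ}

theorem norm_dilation_term (hr0 : 0 < r) (n : ℕ) :
    ‖(r : ℂ) ^ n • InnerProductSpace.rankOne ℂ (monomial n) (monomial n)‖ = r ^ n := by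
  rw [norm_smul, InnerProductSpace.norm_rankOne, norm_monomial, norm_pow, Complex.norm_real,
    Real.norm_of_nonneg hr0.le, mul_one, mul_one]

theorem summable_dilation (hr0 : 0 < r) (hr1 : r < 1) : Summable fun n : ℕ =>
    (r : ℂ) ^ n • InnerProductSpace.rankOne ℂ (monomial n) (monomial n) := by
  refine Summable.of_norm ?_
  simpa only [norm_dilation_term hr0] using summable_geometric_of_lt_one hr0.le hr1

theorem dilation_monomial (hr0 : 0 < r) (hr1 : r < 1) (n : ℕ) :
    dilation r (monomial n) = (r : ℂ) ^ n • monomial n := by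
  have h := (ContinuousLinearMap.apply ℂ HardySpace (monomial n)).map_tsum
    (summable_dilation hr0 hr1)
  rw [ContinuousLinearMap.apply_apply] at h
  refine h.trans ((tsum_eq_single n fun m hm => ?_).trans ?_)
  · simp [orthonormal_monomial.2 hm]
  · simp [norm_monomial]

theorem dilation_kernel (hr0 : 0 < r) (hr1 : r < 1) {u : ℂ} (hu : ‖u‖ < 1) :
    dilation r (kernel u) = kernel (r * u) := by
  rw [kernel, (dilation r).map_tsum (summable_kernel hu)]
  refine tsum_congr fun n => ?_
  rw [map_smul, dilation_monomial hr0 hr1, smul_smul, mul_pow, mul_comm]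

theorem denseRange_dilation (hr0 : 0 < r) (hr1 : r < 1) : DenseRange (dilation r) := by
  have h : (Submodule.span ℂ (Set.range monomial) : Submodule ℂ HardySpace) ≤
      LinearMap.range (dilation r : HardySpace →ₗ[ℂ] HardySpace) := by
    rw [Submodule.span_le]
    rintro _ ⟨n, rfl⟩
    refine ⟨((r : ℂ) ^ n)⁻¹ • monomial n, ?_⟩
    have : (r : ℂ) ^ n ≠ 0 := pow_ne_zero _ (by exact_mod_cast hr0.ne')
    rw [map_smul, ContinuousLinearMap.coe_coe, dilation_monomial hr0 hr1, smul_smul,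
      inv_mul_cancel₀ this, one_smul]
  exact dense_span_monomial.mono h

/-- Truncating the diagonal series after N terms leaves a geometric tail in operator norm. -/
theorem approxNumber_dilation_le (hr0 : 0 < r) (hr1 : r < 1) (N : ℕ) :
    approxNumber (dilation r) (N + 1) ≤ (1 - r)⁻¹ * r ^ N := by
  have hs := summable_dilation hr0 hr1
  set D : ℕ → HardySpace →L[ℂ] HardySpace := fun n =>
    (r : ℂ) ^ n • InnerProductSpace.rankOne ℂ (monomial n) (monomial n) with hD
  have hrank : ((∑ n ∈ Finset.range N, D n : HardySpace →L[ℂ] HardySpace) :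
      HardySpace →ₗ[ℂ] HardySpace).rank < ((N + 1 : ℕ) : Cardinal) := by
    have h1 : ∀ n, (D n : HardySpace →ₗ[ℂ] HardySpace).rank ≤ 1 := by
      intro n
      have h2 : LinearMap.range (D n : HardySpace →ₗ[ℂ] HardySpace) ≤
          Submodule.span ℂ {monomial n} := by
        rintro _ ⟨f, rfl⟩
        refine Submodule.mem_span_singleton.2 ⟨(r : ℂ) ^ n * ⟪monomial n, f⟫_ℂ, ?_⟩
        simp [hD, mul_smul]
      exact (Submodule.rank_mono h2).trans ((rank_span_le _).trans (by simp))
    have h3 := LinearMap.rank_finsetSum_le (Finset.range N)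
      fun n => (D n : HardySpace →ₗ[ℂ] HardySpace)
    rw [ContinuousLinearMap.toLinearMap_sum]
    refine (h3.trans ((Finset.sum_le_sum fun n _ => h1 n).trans_eq ?_)).trans_lt
      (Nat.cast_lt.2 (Nat.lt_succ_self N))
    simp
  refine (approxNumber_le hrank).trans ?_
  have h4 : dilation r - ∑ n ∈ Finset.range N, D n = ∑' n, D (n + N) := by
    rw [sub_eq_iff_eq_add', hs.sum_add_tsum_nat_add N]
    rfl
  have hg := (summable_geometric_of_lt_one hr0.le hr1)
  have h5 : ∀ n, ‖D (n + N)‖ = r ^ n * r ^ N := fun n => by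
    rw [hD, norm_dilation_term hr0, pow_add]
  rw [h4]
  refine (norm_tsum_le_tsum_norm ?_).trans_eq ?_
  · simpa only [h5] using hg.mul_right (r ^ N)
  · simp only [h5]
    rw [tsum_mul_right, tsum_geometric_of_lt_one hr0.le hr1]

theorem summable_approxNumber_dilation (hr0 : 0 < r) (hr1 : r < 1) {p : ℝ} (hp : 1 ≤ p) :
    Summable fun n : ℕ => approxNumber (dilation r) (n + 1) ^ p := by
  have hp0 : 0 < p := by linarith
  have h1r : 0 ≤ (1 - r)⁻¹ := inv_nonneg.2 (by linarith)
  refine Summable.of_nonneg_of_le (fun n => Real.rpow_nonneg (approxNumber_nonneg _ _) _)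
    (fun n => ?_) ((summable_geometric_of_lt_one (Real.rpow_nonneg hr0.le p)
      (Real.rpow_lt_one hr0.le hr1 hp0)).mul_left ((1 - r)⁻¹ ^ p))
  refine (Real.rpow_le_rpow (approxNumber_nonneg _ _) (approxNumber_dilation_le hr0 hr1 n)
    hp0.le).trans_eq ?_
  rw [Real.mul_rpow h1r (by positivity), ← Real.rpow_natCast, ← Real.rpow_natCast,
    ← Real.rpow_mul hr0.le, ← Real.rpow_mul hr0.le, mul_comm p]

end HardySpace

theorem norm_ofReal_mul_lt_one {r : ℝ} (hr0 : 0 < r) (hr1 : r < 1) {z : ℂ} (hz : ‖z‖ < 1) :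
    ‖(r : ℂ) * z‖ < 1 := by
  rw [norm_mul, Complex.norm_real, Real.norm_of_nonneg hr0.le]
  exact mul_lt_one_of_nonneg_of_lt_one_left hr0.le hr1 hz.le

theorem IsBoundedAnalytic.comp_dilation {φ : ℂ → ℂ} (hφ : IsBoundedAnalytic φ) {r : ℝ}
    (hr0 : 0 < r) (hr1 : r < 1) : IsBoundedAnalytic fun z => φ (r * z) := by
  refine ⟨fun z hz => ?_, ?_⟩
  · have : (r : ℂ) * z ∈ Metric.ball (0 : ℂ) 1 :=
      mem_ball_zero_iff.2 (norm_ofReal_mul_lt_one hr0 hr1 (mem_ball_zero_iff.1 hz))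
    exact (hφ.analytic _ this).comp (analyticAt_const.mul analyticAt_id)
  · obtain ⟨C, hC⟩ := hφ.bounded
    exact ⟨C, fun z => hC (Complex.UnitDisc.mk _ (norm_ofReal_mul_lt_one hr0 hr1 z.norm_lt_one))⟩

open HardySpace in
theorem adjoint_mulOp_comp_dilation {φ : ℂ → ℂ} (hφ : IsBoundedAnalytic φ) {r : ℝ}
    (hr0 : 0 < r) (hr1 : r < 1) :
    ContinuousLinearMap.adjoint (mulOp hφ) ∘L dilation r =
      dilation r ∘L ContinuousLinearMap.adjoint (mulOp (hφ.comp_dilation hr0 hr1)) := by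
  refine ContinuousLinearMap.ext_on (dense_span_kernel (W := Set.univ)
    fun f hf => Subtype.ext (funext fun z => hf z trivial)) ?_
  rintro _ ⟨w, -, rfl⟩
  have hw : ‖starRingEnd ℂ (w : ℂ)‖ < 1 := by simpa using w.norm_lt_one
  simp only [ContinuousLinearMap.comp_apply]
  rw [adjoint_mulOp_kernel _ hw, map_smul, dilation_kernel hr0 hr1 hw,
    adjoint_mulOp_kernel hφ (norm_ofReal_mul_lt_one hr0 hr1 hw)]
  simp

theorem frequentlyHypercyclic_conjSchatten {φ ψ : ℂ → ℂ} (hφ : IsBoundedAnalytic φ)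
    (hψ : IsBoundedAnalytic ψ) (hnc : (∃ z w : 𝔻, φ z ≠ φ w) ∨ (∃ z w : 𝔻, ψ z ≠ ψ w))
    (h1 : ∃ z w : 𝔻, ‖φ z * ψ w‖ = 1) {p : ℝ} (hp : 1 ≤ p) :
    FrequentlyHypercyclic
      (conjSchatten p hp (ContinuousLinearMap.adjoint (mulOp hφ)) (mulOp hψ)) := by
  obtain ⟨z₀, w₀, h1⟩ := h1
  -- With |z₀| < r < 1, the point z₀/r lies in the disc, and φ(r·) takes there the value φ(z₀).
  obtain ⟨r, hr, hr1⟩ := exists_between z₀.norm_lt_one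
  have hr0 : 0 < r := (norm_nonneg _).trans_lt hr
  have hrc : (r : ℂ) ≠ 0 := by exact_mod_cast hr0.ne'
  have hz : ‖(z₀ : ℂ) / r‖ < 1 := by
    rwa [norm_div, Complex.norm_real, Real.norm_of_nonneg hr0.le, div_lt_one hr0]
  refine FrequentlyHypercyclic.conjSchatten_of_conjCompact hp
    (HardySpace.denseRange_dilation hr0 hr1)
    (HardySpace.summable_approxNumber_dilation hr0 hr1 hp)
    (adjoint_mulOp_comp_dilation hφ hr0 hr1)
    (frequentlyHypercyclic_conjCompact (hφ.comp_dilation hr0 hr1) hψ (hnc.imp_left ?_)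
      ⟨Complex.UnitDisc.mk _ hz, w₀, ?_⟩)
  · intro hne
    by_contra! h
    -- If φ(r·) were constant, φ would be constant on the disc of radius r, hence everywhere.
    have hconst : ∀ᶠ z in nhds (0 : ℂ), φ z = φ 0 := by
      filter_upwards [Metric.ball_mem_nhds (0 : ℂ) hr0] with z hzr
      have hz1 : ‖z / r‖ < 1 := by
        rw [norm_div, Complex.norm_real, Real.norm_of_nonneg hr0.le, div_lt_one hr0]
        exact mem_ball_zero_iff.1 hzr
      have := h (Complex.UnitDisc.mk _ hz1) 0
      simpa [mul_div_cancel₀ _ hrc] using this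
    have heq := hφ.analytic.eqOn_of_preconnected_of_eventuallyEq (analyticOnNhd_const (v := φ 0))
      (convex_ball 0 1).isPreconnected (Metric.mem_ball_self one_pos) hconst
    obtain ⟨z, w, hzw⟩ := hne
    exact hzw ((heq (mem_ball_zero_iff.2 z.norm_lt_one)).trans
      (heq (mem_ball_zero_iff.2 w.norm_lt_one)).symm)
  · rw [Complex.UnitDisc.coe_mk, mul_div_cancel₀ _ hrc, h1]

/-! ### Necessity of a unimodular value -/

/-- Norm-decreasing orbits stay bounded and norm-increasing ones stay away from 0, so neither is
dense. Measuring through L allows the operator norm to be used on the Schatten classes. -/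
theorem FrequentlyHypercyclic.not_norm_monotone {X E : Type*} [AddCommGroup X] [Module ℂ X]
    [TopologicalSpace X] [NormedAddCommGroup E] [NormedSpace ℂ E] {T : X →L[ℂ] X}
    (hT : FrequentlyHypercyclic T) (L : X →ₗ[ℂ] E) (hLc : Continuous L)
    (hLi : Function.Injective L) (hne : ∃ x : X, x ≠ 0) :
    ¬ (∀ x, ‖L (T x)‖ ≤ ‖L x‖) ∧ ¬ (∀ x, ‖L x‖ ≤ ‖L (T x)‖) := by
  obtain ⟨x, hx⟩ := hT.exists_iterate_mem
  obtain ⟨y, hy⟩ := hne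
  have hLy : 0 < ‖L y‖ := norm_pos_iff.2 fun h => hy (hLi (by rw [h, map_zero]))
  constructor
  · intro h
    have hit : ∀ n, ‖L ((⇑T)^[n] x)‖ ≤ ‖L x‖ := by
      intro n
      induction n with
      | zero => exact le_rfl
      | succ n ih =>
        rw [Function.iterate_succ_apply']
        exact (h _).trans ih
    obtain ⟨n, hn⟩ := hx {z | ‖L x‖ < ‖L z‖} (isOpen_lt continuous_const hLc.norm)
      ⟨(((‖L x‖ + 1) / ‖L y‖ : ℝ) : ℂ) • y, by
        rw [Set.mem_ofPred_eq, map_smul, norm_smul, Complex.norm_real,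
          Real.norm_of_nonneg (by positivity), div_mul_cancel₀ _ hLy.ne']
        linarith⟩
    exact (hit n).not_gt hn
  · intro h
    have hit : ∀ n, ‖L x‖ ≤ ‖L ((⇑T)^[n] x)‖ := by
      intro n
      induction n with
      | zero => exact le_rfl
      | succ n ih =>
        rw [Function.iterate_succ_apply']
        exact ih.trans (h _)
    -- The orbit of 0 has no positive norm to stay above, but it is constant and misses every
    -- non-zero vector.
    rcases eq_or_ne x 0 with rfl | hx0
    · obtain ⟨n, hn⟩ := hx {z | 0 < ‖L z‖} (isOpen_lt continuous_const hLc.norm) ⟨y, hLy⟩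
      rw [Function.iterate_fixed (map_zero T)] at hn
      simp at hn
    · have hLx : 0 < ‖L x‖ := norm_pos_iff.2 fun h => hx0 (hLi (by rw [h, map_zero]))
      obtain ⟨n, hn⟩ := hx {z | ‖L z‖ < ‖L x‖} (isOpen_lt hLc.norm continuous_const)
        ⟨0, by simpa using hLx⟩
      exact (hit n).not_gt hn

theorem norm_mulOp_le {φ : ℂ → ℂ} (hφ : IsBoundedAnalytic φ) {C : ℝ} (hC : ∀ z : 𝔻, ‖φ z‖ ≤ C) :
    ‖mulOp hφ‖ ≤ C := by
  refine ContinuousLinearMap.opNorm_le_bound _ ((norm_nonneg _).trans (hC 0)) fun f => ?_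
  obtain ⟨b, hb, hn⟩ := exists_mul_coeff hφ.analytic hC (HardySpace.coeffEquiv f)
  rw [HardySpace.powerSeriesMap_coeffEquiv] at hb
  refine le_trans (le_of_eq ?_) hn
  rw [HardySpace.norm_def]
  congr 1
  apply powerSeriesMap_injective
  rw [HardySpace.powerSeriesMap_coeffEquiv, hb]
  rfl

theorem norm_mulOp_mul_norm_mulOp_le_one {φ ψ : ℂ → ℂ} (hφ : IsBoundedAnalytic φ)
    (hψ : IsBoundedAnalytic ψ) (h : ∀ z w : 𝔻, ‖φ z * ψ w‖ ≤ 1) :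
    ‖mulOp hφ‖ * ‖mulOp hψ‖ ≤ 1 := by
  -- The supremum is taken over z with w fixed, and only afterwards over w.
  have h1 : ∀ w : 𝔻, ‖mulOp hφ‖ * ‖ψ w‖ ≤ 1 := by
    intro w
    rcases (norm_nonneg (ψ w)).eq_or_lt with h0 | h0
    · simp [← h0]
    · rw [← le_div_iff₀ h0]
      refine norm_mulOp_le hφ fun z => ?_
      rw [le_div_iff₀ h0, ← norm_mul]
      exact h z w
  rcases (norm_nonneg (mulOp hφ)).eq_or_lt with h0 | h0
  · simp [← h0]
  · rw [mul_comm, ← le_div_iff₀ h0]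
    refine norm_mulOp_le hψ fun w => ?_
    rw [le_div_iff₀ h0, mul_comm]
    exact h1 w

theorem norm_comp_comp_le_of_mul_le_one {H : Type*} [NormedAddCommGroup H]
    [InnerProductSpace ℂ H] {R T : H →L[ℂ] H} (h : ‖R‖ * ‖T‖ ≤ 1) (S : H →L[ℂ] H) :
    ‖R ∘L S ∘L T‖ ≤ ‖S‖ :=
  calc ‖R ∘L S ∘L T‖ ≤ ‖R‖ * (‖S‖ * ‖T‖) :=
        (R.opNorm_comp_le _).trans
          (mul_le_mul_of_nonneg_left (S.opNorm_comp_le T) (norm_nonneg _))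
    _ = ‖R‖ * ‖T‖ * ‖S‖ := by ring
    _ ≤ ‖S‖ := mul_le_of_le_one_left (norm_nonneg _) h

theorem mulOp_comp_mulOp_eq_id {φ χ : ℂ → ℂ} (hφ : IsBoundedAnalytic φ)
    (hχ : IsBoundedAnalytic χ) (h : ∀ z : 𝔻, φ z * χ z = 1) :
    mulOp hφ ∘L mulOp hχ = ContinuousLinearMap.id ℂ HardySpace := by
  ext f
  refine Subtype.ext (funext fun z => ?_)
  change φ z * (χ z * f z) = f z
  rw [← mul_assoc, h, one_mul]

theorem IsBoundedAnalytic.inv {φ : ℂ → ℂ} (hφ : IsBoundedAnalytic φ) {c : ℝ} (hc : 0 < c)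
    (h : ∀ z : 𝔻, c ≤ ‖φ z‖) : IsBoundedAnalytic fun z => (φ z)⁻¹ := by
  refine ⟨fun z hz => (hφ.analytic z hz).inv fun h0 => ?_, ⟨c⁻¹, fun z => ?_⟩⟩
  · have := h (Complex.UnitDisc.mk z (mem_ball_zero_iff.1 hz))
    rw [Complex.UnitDisc.coe_mk, h0, norm_zero] at this
    exact this.not_gt hc
  · rw [norm_inv]
    exact inv_anti₀ hc (h z)

/-- If `φ(z) ψ(w)` is never unimodular, then `S ↦ M_φ^* S M_ψ` or its inverse is contractive for
the operator norm. -/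
theorem norm_monotone_of_no_unimodular {φ ψ : ℂ → ℂ} (hφ : IsBoundedAnalytic φ)
    (hψ : IsBoundedAnalytic ψ) (h : ¬ ∃ z w : 𝔻, ‖φ z * ψ w‖ = 1) :
    (∀ S : HardySpace →L[ℂ] HardySpace,
      ‖ContinuousLinearMap.adjoint (mulOp hφ) ∘L S ∘L mulOp hψ‖ ≤ ‖S‖) ∨
    (∀ S : HardySpace →L[ℂ] HardySpace,
      ‖S‖ ≤ ‖ContinuousLinearMap.adjoint (mulOp hφ) ∘L S ∘L mulOp hψ‖) := by
  set B : Set (ℂ × ℂ) := Metric.ball 0 1 ×ˢ Metric.ball 0 1 with hB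
  have hpre : IsPreconnected B :=
    ((convex_ball 0 1).prod (convex_ball 0 1)).isPreconnected
  set g : ℂ × ℂ → ℝ := fun q => ‖φ q.1 * ψ q.2‖ with hg
  have hgc : ContinuousOn g B := by
    refine ContinuousOn.norm (ContinuousOn.mul ?_ ?_)
    · exact hφ.analytic.continuousOn.comp continuousOn_fst fun q hq => hq.1
    · exact hψ.analytic.continuousOn.comp continuousOn_snd fun q hq => hq.2
  have hmem : ∀ z w : 𝔻, ((z : ℂ), (w : ℂ)) ∈ B := fun z w =>
    ⟨mem_ball_zero_iff.2 z.norm_lt_one, mem_ball_zero_iff.2 w.norm_lt_one⟩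
  by_cases hle : ∀ z w : 𝔻, ‖φ z * ψ w‖ ≤ 1
  · refine Or.inl (norm_comp_comp_le_of_mul_le_one ?_)
    rw [LinearIsometryEquiv.norm_map]
    exact norm_mulOp_mul_norm_mulOp_le_one hφ hψ hle
  · push Not at hle
    obtain ⟨z₁, w₁, h1⟩ := hle
    have hge : ∀ z w : 𝔻, 1 ≤ ‖φ z * ψ w‖ := by
      intro z w
      by_contra! hlt
      obtain ⟨q, hq, hq1⟩ := hpre.intermediate_value (hmem z w) (hmem z₁ w₁) hgc ⟨hlt.le, h1.le⟩
      exact h ⟨Complex.UnitDisc.mk _ (mem_ball_zero_iff.1 hq.1),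
        Complex.UnitDisc.mk _ (mem_ball_zero_iff.1 hq.2), hq1⟩
    have hφ0 : ∀ z : 𝔻, 0 < ‖φ z‖ := fun z => norm_pos_iff.2 fun h0 => by
      have := hge z 0
      simp [h0] at this
      linarith
    have hψ0 : ∀ w : 𝔻, 0 < ‖ψ w‖ := fun w => norm_pos_iff.2 fun h0 => by
      have := hge 0 w
      simp [h0] at this
      linarith
    -- Fixing the other variable at 0 gives |φ(z)| ≥ 1/|ψ(0)|, so 1/φ is bounded; likewise for 1/ψ
    -- below.
    have hφ' := hφ.inv (inv_pos.2 (hψ0 0)) fun z => by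
      rw [inv_le_iff_one_le_mul₀ (hψ0 0), ← norm_mul]
      exact hge z 0
    have hψ' := hψ.inv (inv_pos.2 (hφ0 0)) fun w => by
      rw [inv_le_iff_one_le_mul₀ (hφ0 0), mul_comm, ← norm_mul]
      exact hge 0 w
    refine Or.inr fun S => ?_
    have hn : ‖ContinuousLinearMap.adjoint (mulOp hφ')‖ * ‖mulOp hψ'‖ ≤ 1 := by
      rw [LinearIsometryEquiv.norm_map]
      refine norm_mulOp_mul_norm_mulOp_le_one hφ' hψ' fun z w => ?_
      rw [← mul_inv, norm_inv]
      exact inv_le_one_of_one_le₀ (hge z w)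
    have e1 : ContinuousLinearMap.adjoint (mulOp hφ') ∘L ContinuousLinearMap.adjoint (mulOp hφ) =
        ContinuousLinearMap.id ℂ HardySpace := by
      rw [← ContinuousLinearMap.adjoint_comp, mulOp_comp_mulOp_eq_id hφ hφ' fun z =>
        mul_inv_cancel₀ (norm_pos_iff.1 (hφ0 z)), ContinuousLinearMap.adjoint_id]
    have e2 : mulOp hψ ∘L mulOp hψ' = ContinuousLinearMap.id ℂ HardySpace :=
      mulOp_comp_mulOp_eq_id hψ hψ' fun w => mul_inv_cancel₀ (norm_pos_iff.1 (hψ0 w))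
    have e3 : ContinuousLinearMap.adjoint (mulOp hφ') ∘L
        (ContinuousLinearMap.adjoint (mulOp hφ) ∘L S ∘L mulOp hψ) ∘L mulOp hψ' = S :=
      calc _ = (ContinuousLinearMap.adjoint (mulOp hφ') ∘L
            ContinuousLinearMap.adjoint (mulOp hφ)) ∘L S ∘L (mulOp hψ ∘L mulOp hψ') := rfl
        _ = S := by
          rw [e1, e2, ContinuousLinearMap.id_comp, ContinuousLinearMap.comp_id]
    have := norm_comp_comp_le_of_mul_le_one hn
      (ContinuousLinearMap.adjoint (mulOp hφ) ∘L S ∘L mulOp hψ)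
    rwa [e3] at this

/-! ### Comparison of the Schatten norm with the operator norm -/

namespace SchattenClass

variable {H : Type*} [NormedAddCommGroup H] [InnerProductSpace ℂ H] {p : ℝ} {hp : 1 ≤ p}

/-- The operator norm is the first approximation number, a single term of the ℓ^p sum. -/
theorem norm_toCLM_le (S : SchattenClass H p hp) : ‖toCLM S‖ ≤ schattenNorm S := by
  have hp0 : 0 < p := by linarith
  have hS : Summable fun n : ℕ => approxNumber (toCLM S) (n + 1) ^ p := S.2
  have h := hS.le_tsum 0 fun n _ => Real.rpow_nonneg (approxNumber_nonneg _ _) _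
  rw [zero_add, approxNumber_one] at h
  calc ‖toCLM S‖ = (‖toCLM S‖ ^ p) ^ (1 / p) := by
        rw [← Real.rpow_mul (norm_nonneg _), mul_one_div_cancel hp0.ne', Real.rpow_one]
    _ ≤ _ := Real.rpow_le_rpow (by positivity) h (by positivity)

theorem continuous_toCLM : Continuous (toCLM : SchattenClass H p hp → H →L[ℂ] H) := by
  refine continuous_def.2 fun U hU S hS => ?_
  obtain ⟨ε, hε, hεU⟩ := Metric.isOpen_iff.1 hU _ hS
  refine ⟨ε, hε, fun S' hS' => hεU ?_⟩
  rw [mem_ball_iff_norm, ← map_sub]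
  exact (norm_toCLM_le _).trans_lt hS'

end SchattenClass

end

theorem mainTheorem2 (φ ψ : ℂ → ℂ) (hφ : IsBoundedAnalytic φ) (hψ : IsBoundedAnalytic ψ)
    (hφ0 : ∃ z : 𝔻, φ z ≠ 0) (hψ0 : ∃ z : 𝔻, ψ z ≠ 0)
    (hnc : (∃ z w : 𝔻, φ z ≠ φ w) ∨ (∃ z w : 𝔻, ψ z ≠ ψ w)) :
    ((∃ z w : 𝔻, ‖φ z * ψ w‖ = 1) →
      (∀ (p : ℝ) (hp : 1 ≤ p), FrequentlyHypercyclic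
        (conjSchatten p hp (ContinuousLinearMap.adjoint (mulOp hφ)) (mulOp hψ))) ∧
      FrequentlyHypercyclic
        (conjCompact (ContinuousLinearMap.adjoint (mulOp hφ)) (mulOp hψ)) ∧
      FrequentlyHypercyclic
        (conjCOT (ContinuousLinearMap.adjoint (mulOp hφ)) (mulOp hψ))) ∧
    (FrequentlyHypercyclic
        (conjCompact (ContinuousLinearMap.adjoint (mulOp hφ)) (mulOp hψ)) →
      ∃ z w : 𝔻, ‖φ z * ψ w‖ = 1) ∧
    (∀ (p : ℝ) (hp : 1 ≤ p), FrequentlyHypercyclic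
        (conjSchatten p hp (ContinuousLinearMap.adjoint (mulOp hφ)) (mulOp hψ)) →
      ∃ z w : 𝔻, ‖φ z * ψ w‖ = 1) := by
  refine ⟨fun h1 => ?_, fun hF => ?_, fun p hp hF => ?_⟩
  · have hK := frequentlyHypercyclic_conjCompact hφ hψ hnc h1
    exact ⟨fun p hp => frequentlyHypercyclic_conjSchatten hφ hψ hnc h1 hp, hK,
      hK.conjCOT_of_conjCompact⟩
  · by_contra h
    have hne : ∃ S : compactOperator (RingHom.id ℂ) HardySpace HardySpace, S ≠ 0 :=
      ⟨compactRankOne (HardySpace.monomial 0) (HardySpace.monomial 0), fun h0 => by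
        have := norm_compactRankOne (HardySpace.monomial 0) (HardySpace.monomial 0)
        rw [h0, norm_zero, HardySpace.norm_monomial] at this
        norm_num at this⟩
    obtain ⟨h1, h2⟩ := hF.not_norm_monotone
      (compactOperator (RingHom.id ℂ) HardySpace HardySpace).subtype continuous_subtype_val
      Subtype.val_injective hne
    rcases norm_monotone_of_no_unimodular hφ hψ h with h' | h'
    · exact h1 fun S => h' S
    · exact h2 fun S => h' S
  · by_contra h
    have hr0 : (0 : ℝ) < 1 / 2 := by norm_num
    have hr1 : (1 / 2 : ℝ) < 1 := by norm_num
    -- A dilation serves as a non-zero element, being already known to lie in every Schatten class.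
    have hne : ∃ S : SchattenClass HardySpace p hp, S ≠ 0 :=
      ⟨⟨HardySpace.dilation (1 / 2),
        HardySpace.summable_approxNumber_dilation hr0 hr1 hp⟩, fun h0 => by
        have h3 : HardySpace.dilation (1 / 2) = 0 := congrArg SchattenClass.toCLM h0
        have h4 := HardySpace.dilation_monomial hr0 hr1 0
        have h5 := HardySpace.norm_monomial 0
        rw [h3, pow_zero, one_smul, zero_apply] at h4
        rw [← h4, norm_zero] at h5
        norm_num at h5⟩
    obtain ⟨h1, h2⟩ := hF.not_norm_monotone SchattenClass.toCLM SchattenClass.continuous_toCLM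
      Subtype.val_injective hne
    rcases norm_monotone_of_no_unimodular hφ hψ h with h' | h'
    · exact h1 fun S => h' _
    · exact h2 fun S => h' _
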